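/- Let $m$ be Lebesgue measure on $(0,\infty)$, and let functions be real-valued, measurable and identified when equal a.e. A symmetric space on $(0,\infty)$ is a nonzero Banach space $X$ of measurable functions on $(0,\infty)$ such that (i) if $|f|\le |g|$ a.e. and $g\in X$, then $f\in X$ and $\|f\|_X\le\|g\|_X$; (ii) if $g\in X$ and $m\{|f|>\tau\}=m\{|g|>\tau\}$ for all $\tau>0$, then $f\in X$ and $\|f\|_X=\|g\|_X$. The space $X$ satisfies an upper $p$-estimate (respectively, a lower $q$-estimate) if there is a constant $C$ such that, for all $n$ and all pairwise disjoint $f_1,\dots,f_n\in X$ (that is, $f_if_j=0$ a.e. for $i\ne j$), $\|\sum_i f_i\|_X\le C\,(\sum_i\|f_i\|_X^p)^{1/p}$ (respectively, $(\sum_i\|f_i\|_X^q)^{1/q}\le C\,\|\sum_i f_i\|_X$). The space $X\cap L_\infty$ carries the norm $\max(\|f\|_X,\|f\|_{L_\infty})$, the space $X+L_\infty$ carries the norm $\inf\{\|u\|_X+\|v\|_{L_\infty}: f=u+v,\ u\in X,\ v\in L_\infty\}$, and $X[0,1]$ is the subspace of all $f\in X$ vanishing a.e. outside $[0,1]$.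 A subspace is complemented if it is the range of a bounded linear projection, and isomorphic means linearly homeomorphic. **Theorem 5.** Let $X$ be a separable symmetric space on $(0,\infty)$ that satisfies either an upper $p$-estimate for some real $p>2$ or a lower $q$-estimate for some real $1\le q<2$. Then $X\cap L_\infty$ does not contain any complemented subspace isomorphic to $l_2$. If, in addition, $X[0,1]$ contains a complemented subspace isomorphic to $l_2$, then $X\cap L_\infty$ and $X+L_\infty$ are not isomorphic. -/

import Mathlib

open MeasureTheory Set
open scoped ENNReal

noncomputable section

namespace SymmSpaces

/-- Lebesgue measure on the half-line `(0, ∞)`. -/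
abbrev halfLine : Measure ℝ := volume.restrict (Ioi 0)

/-- Real measurable functions on `(0, ∞)`, modulo equality almost everywhere. -/
abbrev L0 : Type := ℝ →ₘ[halfLine] ℝ

/-- An extended norm on the measurable functions: a norm that may take the value `∞`. Giving such an
object is the same as giving a linear subspace of `L0` (where it is finite) with a norm on it. -/
structure ExtNorm where
  toFun : L0 → ℝ≥0∞
  eq_zero : ∀ f, toFun f = 0 → f = 0
  smul : ∀ (c : ℝ) (f), toFun (c • f) = ‖c‖ₑ * toFun f
  add_le : ∀ f g, toFun (f + g) ≤ toFun f + toFun g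

namespace ExtNorm

theorem map_zero (ρ : ExtNorm) : ρ.toFun 0 = 0 := by
  simpa using ρ.smul 0 0

/-- The space of all functions of finite norm. -/
def space (ρ : ExtNorm) : Submodule ℝ L0 where
  carrier := {f | ρ.toFun f ≠ ∞}
  zero_mem' := by simp [ρ.map_zero]
  add_mem' {f g} hf hg :=
    ne_top_of_le_ne_top (ENNReal.add_ne_top.2 ⟨hf, hg⟩) (ρ.add_le f g)
  smul_mem' c f hf := by
    simp only [mem_ofPred_eq] at hf ⊢
    rw [ρ.smul]
    exact ENNReal.mul_ne_top (by simp) hf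

instance (ρ : ExtNorm) : Norm ρ.space := ⟨fun f => (ρ.toFun f).toReal⟩

theorem norm_def (ρ : ExtNorm) (f : ρ.space) : ‖f‖ = (ρ.toFun f).toReal := rfl

theorem core (ρ : ExtNorm) : NormedSpace.Core ℝ ρ.space where
  norm_nonneg f := ENNReal.toReal_nonneg
  norm_smul c f := by
    rw [norm_def, norm_def, Submodule.coe_smul, ρ.smul, ENNReal.toReal_mul]
    simp
  norm_triangle f g := by
    rw [norm_def, norm_def, norm_def, Submodule.coe_add, ← ENNReal.toReal_add f.2 g.2]
    exact ENNReal.toReal_mono (ENNReal.add_ne_top.2 ⟨f.2, g.2⟩) (ρ.add_le _ _)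
  norm_eq_zero_iff f := by
    constructor
    · intro h
      rw [norm_def, ENNReal.toReal_eq_zero_iff] at h
      exact Subtype.ext (ρ.eq_zero _ (h.resolve_right f.2))
    · rintro rfl
      simp [norm_def, ρ.map_zero]

instance (ρ : ExtNorm) : NormedAddCommGroup ρ.space := NormedAddCommGroup.ofCore ρ.core

instance (ρ : ExtNorm) : NormedSpace ℝ ρ.space := NormedSpace.ofCore ρ.core

end ExtNorm

/-- A symmetric (rearrangement invariant) space on `(0, ∞)`: a nonzero Banach space `X` of measurable
functions (those of finite norm) which is an ideal lattice (`|f| ≤ |g|` a.e. and `g ∈ X` imply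
`f ∈ X` and `‖f‖ ≤ ‖g‖`) and in which equimeasurable functions have the same norm. -/
structure SymmetricSpace extends ExtNorm where
  mono : ∀ f g : L0, |f| ≤ |g| → toFun f ≤ toFun g
  equimeasurable : ∀ f g : L0,
    (∀ τ : ℝ, 0 < τ → halfLine {t | τ < |f t|} = halfLine {t | τ < |g t|}) → toFun f = toFun g
  nontrivial : ∃ f : L0, f ≠ 0 ∧ toFun f ≠ ∞
  complete : CompleteSpace toExtNorm.space

/-- The norm of `L_∞(0, ∞)`, the essential supremum of `|f|`. -/
abbrev supNorm (f : L0) : ℝ≥0∞ := eLpNorm f ∞ halfLine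

theorem supNorm_smul (c : ℝ) (f : L0) : supNorm (c • f) = ‖c‖ₑ * supNorm f := by
  rw [supNorm, eLpNorm_congr_ae (AEEqFun.coeFn_smul c f), eLpNorm_const_smul]

theorem supNorm_add_le (f g : L0) : supNorm (f + g) ≤ supNorm f + supNorm g := by
  rw [supNorm, eLpNorm_congr_ae (AEEqFun.coeFn_add f g)]
  exact eLpNorm_add_le f.aestronglyMeasurable g.aestronglyMeasurable le_top

namespace SymmetricSpace

/-- `X ∩ L_∞` with the norm `max (‖f‖_X) (‖f‖_∞)`. -/
def interLinfty (X : SymmetricSpace) : ExtNorm where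
  toFun f := max (X.toFun f) (supNorm f)
  eq_zero f h := X.eq_zero f (le_antisymm ((le_max_left _ _).trans h.le) bot_le)
  smul c f := by rw [X.smul, supNorm_smul, mul_max]
  add_le f g := max_le
    ((X.add_le f g).trans (add_le_add (le_max_left _ _) (le_max_left _ _)))
    ((supNorm_add_le f g).trans (add_le_add (le_max_right _ _) (le_max_right _ _)))

/-- The norm of `X + L_∞`: the infimum of `‖u‖_X + ‖v‖_∞` over all decompositions `f = u + v`. -/
def sumNorm (X : SymmetricSpace) (f : L0) : ℝ≥0∞ :=
  ⨅ (u : L0) (v : L0) (_ : f = u + v), X.toFun u + supNorm v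

theorem sumNorm_le (X : SymmetricSpace) (u v : L0) :
    X.sumNorm (u + v) ≤ X.toFun u + supNorm v :=
  iInf_le_of_le u (iInf_le_of_le v (iInf_le_of_le rfl le_rfl))

theorem exists_of_sumNorm_lt (X : SymmetricSpace) {f : L0} {a : ℝ≥0∞} (h : X.sumNorm f < a) :
    ∃ u v : L0, f = u + v ∧ X.toFun u + supNorm v < a := by
  simpa only [sumNorm, iInf_lt_iff, exists_prop] using h

theorem sumNorm_smul_le (X : SymmetricSpace) (c : ℝ) (f : L0) :
    X.sumNorm (c • f) ≤ ‖c‖ₑ * X.sumNorm f := by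
  by_cases hc : c = 0
  · subst hc
    have h := X.sumNorm_le 0 0
    have h0 : supNorm 0 = 0 := by simpa using supNorm_smul 0 0
    have h1 : X.toFun 0 = 0 := X.map_zero
    simpa [h0, h1] using h
  · have hc0 : ‖c‖ₑ ≠ 0 := by simpa using hc
    have hct : ‖c‖ₑ ≠ ∞ := by simp
    rw [sumNorm.eq_def X f]
    simp only [ENNReal.mul_iInf_of_ne hc0 hct]
    refine le_iInf fun u => le_iInf fun v => le_iInf fun h => ?_
    rw [h, smul_add, mul_add, ← X.smul, ← supNorm_smul]
    exact X.sumNorm_le _ _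

theorem eq_zero_of_sumNorm (X : SymmetricSpace) (f : L0) (hf : X.sumNorm f = 0) : f = 0 := by
  by_contra hne
  -- otherwise `|f| > δ` on a set `A` of positive measure
  obtain ⟨n, hn⟩ : ∃ n : ℕ, halfLine {t | (1 : ℝ) / (n + 1) < |f t|} ≠ 0 := by
    by_contra! h
    refine hne (AEEqFun.ext ?_)
    have h' : ∀ᵐ t ∂halfLine, ∀ n : ℕ, ¬ (1 : ℝ) / (n + 1) < |f t| := by
      rw [ae_all_iff]
      intro n
      rw [ae_iff]
      simpa using h n
    filter_upwards [h', AEEqFun.coeFn_zero (α := ℝ) (β := ℝ) (μ := halfLine)] with t ht h0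
    rw [h0]
    by_contra hft
    obtain ⟨n, hn⟩ := exists_nat_one_div_lt (abs_pos.2 hft)
    exact ht n hn
  set δ : ℝ := 1 / (n + 1) with hδ
  have hδ0 : 0 < δ := by positivity
  set A : Set ℝ := {t | δ < |f t|} with hA
  have hAm : MeasurableSet A :=
    measurableSet_lt measurable_const (AEEqFun.measurable f).abs
  let χ : L0 := AEEqFun.mk (A.indicator fun _ => (1 : ℝ))
    (aestronglyMeasurable_const.indicator hAm)
  have hχ : χ =ᵐ[halfLine] A.indicator fun _ => (1 : ℝ) := AEEqFun.coeFn_mk _ _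
  -- the indicator of `A` has norm at most `(2 / δ) ε` for every small `ε > 0`
  have key : ∀ ε : ℝ≥0∞, 0 < ε → ε < ENNReal.ofReal (δ / 2) →
      ENNReal.ofReal (δ / 2) * X.toFun χ ≤ ε := by
    intro ε hε hεδ
    obtain ⟨u, v, rfl, h⟩ := X.exists_of_sumNorm_lt (hf.trans_lt hε)
    have hu : X.toFun u ≤ ε := le_self_add.trans h.le
    have hv : supNorm v < ENNReal.ofReal (δ / 2) := (le_add_self.trans h.le).trans_lt hεδ
    have hvb : ∀ᵐ t ∂halfLine, |v t| ≤ δ / 2 := by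
      have h1 := ae_le_eLpNormEssSup (f := v) (μ := halfLine)
      rw [supNorm, eLpNorm_exponent_top] at hv
      filter_upwards [h1] with t ht
      have h2 := ht.trans hv.le
      rw [Real.enorm_eq_ofReal_abs] at h2
      exact (ENNReal.ofReal_le_ofReal_iff (by positivity)).1 h2
    have hle : |(δ / 2) • χ| ≤ |u| := by
      rw [← AEEqFun.coeFn_le]
      filter_upwards [AEEqFun.coeFn_abs ((δ / 2) • χ), AEEqFun.coeFn_abs u,
        AEEqFun.coeFn_smul (δ / 2) χ, hχ, hvb, AEEqFun.coeFn_add u v] with t h1 h2 h3 h4 h5 h6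
      rw [h1, h2, h3, Pi.smul_apply, h4]
      by_cases ht : t ∈ A
      · have h7 : δ < |u t + v t| := by
          have h8 : δ < |(u + v) t| := ht
          rwa [h6] at h8
        have h9 := abs_add_le (u t) (v t)
        rw [indicator_of_mem ht, smul_eq_mul, mul_one, abs_of_pos (by positivity)]
        linarith
      · simp [indicator_of_notMem ht]
    have h10 := (X.mono _ _ hle).trans hu
    rwa [X.smul, Real.enorm_of_nonneg (by positivity)] at h10
  have hδe : 0 < ENNReal.ofReal (δ / 2) := by simpa using hδ0
  have hzero : ENNReal.ofReal (δ / 2) * X.toFun χ = 0 := by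
    by_contra h0
    obtain ⟨ε, h1, h2⟩ := exists_between (lt_min (pos_iff_ne_zero.2 h0) hδe)
    exact absurd (key ε h1 (h2.trans_le (min_le_right _ _)))
      (not_le.2 (h2.trans_le (min_le_left _ _)))
  have hχ0 : χ = 0 := X.eq_zero _ ((mul_eq_zero.1 hzero).resolve_left hδe.ne')
  refine hn ?_
  have hae : ∀ᵐ t ∂halfLine, t ∉ A := by
    filter_upwards [hχ, AEEqFun.coeFn_zero (α := ℝ) (β := ℝ) (μ := halfLine)] with t h1 h2 ht
    rw [hχ0, h2, indicator_of_mem ht] at h1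
    simp at h1
  exact measure_eq_zero_iff_ae_notMem.2 hae

/-- `X + L_∞`. -/
def sumLinfty (X : SymmetricSpace) : ExtNorm where
  toFun := X.sumNorm
  eq_zero := X.eq_zero_of_sumNorm
  smul c f := by
    refine le_antisymm (X.sumNorm_smul_le c f) ?_
    by_cases hc : c = 0
    · simp [hc]
    · have hc0 : ‖c‖ₑ ≠ 0 := by simpa using hc
      have h := X.sumNorm_smul_le c⁻¹ (c • f)
      rw [smul_smul, inv_mul_cancel₀ hc, one_smul, enorm_inv hc] at h
      calc ‖c‖ₑ * X.sumNorm f ≤ ‖c‖ₑ * (‖c‖ₑ⁻¹ * X.sumNorm (c • f)) := by gcongr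
        _ = X.sumNorm (c • f) := by
          rw [← mul_assoc, ENNReal.mul_inv_cancel hc0 (by simp), one_mul]
  add_le f g := by
    refine ENNReal.le_of_forall_pos_le_add fun ε hε hfin => ?_
    obtain ⟨hf, hg⟩ := ENNReal.add_lt_top.1 hfin
    have hε2 : (ε / 2 : ℝ≥0∞) ≠ 0 := by simpa using hε.ne'
    obtain ⟨u, v, rfl, h1⟩ := X.exists_of_sumNorm_lt (ENNReal.lt_add_right hf.ne hε2)
    obtain ⟨u', v', rfl, h2⟩ := X.exists_of_sumNorm_lt (ENNReal.lt_add_right hg.ne hε2)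
    calc X.sumNorm (u + v + (u' + v')) = X.sumNorm ((u + u') + (v + v')) := by
          rw [add_add_add_comm]
      _ ≤ X.toFun (u + u') + supNorm (v + v') := X.sumNorm_le _ _
      _ ≤ (X.toFun u + X.toFun u') + (supNorm v + supNorm v') :=
          add_le_add (X.add_le _ _) (supNorm_add_le _ _)
      _ = (X.toFun u + supNorm v) + (X.toFun u' + supNorm v') := by rw [add_add_add_comm]
      _ ≤ (X.sumNorm (u + v) + ε / 2) + (X.sumNorm (u' + v') + ε / 2) :=
          add_le_add h1.le h2.le
      _ = X.sumNorm (u + v) + X.sumNorm (u' + v') + ε := by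
          rw [add_add_add_comm, ENNReal.add_halves]

/-- `X[0, 1]`: the subspace of `X` of all functions that vanish a.e. outside `[0, 1]`. -/
def unitInterval (X : SymmetricSpace) : Submodule ℝ X.space where
  carrier := {f | ∀ᵐ t ∂halfLine, t ∉ Icc (0 : ℝ) 1 → (f : L0) t = 0}
  zero_mem' := by
    filter_upwards [AEEqFun.coeFn_zero (α := ℝ) (β := ℝ) (μ := halfLine)] with t h0 _
    simpa using h0
  add_mem' {f g} hf hg := by
    simp only [mem_ofPred_eq] at hf hg ⊢
    filter_upwards [hf, hg, AEEqFun.coeFn_add (f : L0) (g : L0)] with t h1 h2 h3 ht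
    rw [Submodule.coe_add, h3, Pi.add_apply, h1 ht, h2 ht, add_zero]
  smul_mem' c f hf := by
    simp only [mem_ofPred_eq] at hf ⊢
    filter_upwards [hf, AEEqFun.coeFn_smul c (f : L0)] with t h1 h2 ht
    rw [Submodule.coe_smul, h2, Pi.smul_apply, h1 ht, smul_zero]

/-- The members of a finite family in `X` are pairwise disjoint: `fᵢ fⱼ = 0` a.e. for `i ≠ j`. -/
def PairwiseDisjointFamily (X : SymmetricSpace) {n : ℕ} (f : Fin n → X.space) : Prop :=
  ∀ i j, i ≠ j → ((f i : L0) * (f j : L0)) = 0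

/-- `X` satisfies an upper `p`-estimate. -/
def UpperEstimate (X : SymmetricSpace) (p : ℝ) : Prop :=
  ∃ C : ℝ, ∀ (n : ℕ) (f : Fin n → X.space), X.PairwiseDisjointFamily f →
    ‖∑ i, f i‖ ≤ C * (∑ i, ‖f i‖ ^ p) ^ (1 / p)

/-- `X` satisfies a lower `q`-estimate. -/
def LowerEstimate (X : SymmetricSpace) (q : ℝ) : Prop :=
  ∃ C : ℝ, ∀ (n : ℕ) (f : Fin n → X.space), X.PairwiseDisjointFamily f →
    (∑ i, ‖f i‖ ^ q) ^ (1 / q) ≤ C * ‖∑ i, f i‖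

end SymmetricSpace

/-- The real sequence space `l_2`. -/
abbrev SeqL2 : Type := lp (fun _ : ℕ => ℝ) 2

/-- `E` contains a complemented subspace (the range of a bounded projection) isomorphic to `l_2`. -/
def HasComplementedSeqL2 (E : Type) [NormedAddCommGroup E] [NormedSpace ℝ E] : Prop :=
  ∃ S : Submodule ℝ E, S.ClosedComplemented ∧ Nonempty (S ≃L[ℝ] SeqL2)

end SymmSpaces

end

/-!
# Complemented copies of `l_2` in `X ∩ L_∞` and in `X + L_∞`

If `X ∩ L_∞` contained a complemented copy of `l_2`, there would be a sequence `x n` in it with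
`‖∑ a k • x k‖ ≤ C (∑ a k ^ 2)^{1/2}`, and a bounded operator `Q` into a Hilbert space with
`‖Q (x n)‖ ≥ 1`. This is impossible for the following reason.

The main tool is the little Grothendieck theorem for operators from an ideal lattice into a Hilbert
space, `ExtNorm.IsIdeal.sum_norm_sq_le`: the norm of the square function `(∑ f k ^ 2)^{1/2}` controls
`(∑ ‖Q (f k)‖ ^ 2)^{1/2}`. It holds because the `f k` are the Rademacher coefficients of a Riesz
product that is dominated by a multiple of the square function. The square functions of the sequence
`x n` are bounded by `C`. On a bounded interval the norm of `X ∩ L_∞` is equivalent to that of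
`L_∞`, so the parts of the `x n` on `(0, b]` satisfy `∑ ‖Q (x n 1_{(0, b]})‖ ^ 2 < ∞`. Since
`X` is separable, its norm is order continuous on tails (`tendsto_norm_cut_Ioi`), so far out the
norm of `X ∩ L_∞` on finitely many given functions is dominated by that of `L_∞`, and only finitely
many `x n` can keep a substantial part of `Q (x n)` in all their tails. A gliding hump now yields
pieces `y k` of the `x n` with disjoint supports and `‖Q (y k)‖ ≥ 1 / 4`.

By orthogonality of the signs, `N` of the pieces have a sum of norm at least of order `√N` in
`X ∩ L_∞`; as disjoint functions they stay bounded in `L_∞`, so the sum has norm of order `√N` in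
`X`. This contradicts an upper `p`-estimate with `p > 2`. On the other hand, the sum of the pieces is
dominated by the average of the moduli of the signed sums of the `x n`, so it has norm at most
`C √N`. Under a lower `q`-estimate with `q < 2` this leaves only finitely many pieces with norm above
a given bound in `X`, so there are arbitrarily many pieces whose sum is bounded in `X` and in `L_∞`,
a contradiction again.

Finally, restriction to `[0, 1]` is a projection of `X + L_∞` onto a copy of `X[0, 1]`, since bounded
functions on `[0, 1]` belong to `X`. So a complemented copy of `l_2` in `X[0, 1]` yields one in
`X + L_∞`, which tells `X + L_∞` from `X ∩ L_∞`.
-/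

namespace SymmSpaces

/-! ### Averages over signs -/

/-- The two signs `±1`, indexed by `Bool`. -/
def boolSign (b : Bool) : ℝ := if b then 1 else -1

@[simp] theorem boolSign_true : boolSign true = 1 := rfl

@[simp] theorem boolSign_false : boolSign false = -1 := rfl

theorem boolSign_mul_self (b : Bool) : boolSign b * boolSign b = 1 := by
  cases b <;> simp

theorem abs_boolSign (b : Bool) : |boolSign b| = 1 := by
  cases b <;> simp

section Signs

variable {ι : Type*} [Fintype ι] [DecidableEq ι]

theorem sum_prod_bool {R : Type*} [CommSemiring R] (φ : ι → Bool → R) :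
    ∑ ε : ι → Bool, ∏ k, φ k (ε k) = ∏ k, (φ k true + φ k false) := by
  rw [← Fintype.piFinset_univ, ← Finset.prod_univ_sum]
  simp

/-- Distinct Rademacher functions are orthogonal. -/
theorem sum_boolSign_mul (n m : ι) :
    ∑ ε : ι → Bool, boolSign (ε n) * boolSign (ε m) =
      if n = m then (2 : ℝ) ^ Fintype.card ι else 0 := by
  split_ifs with h
  · subst h
    simp [boolSign_mul_self]
  · have h1 : ∀ ε : ι → Bool, boolSign (ε n) * boolSign (ε m) =
        ∏ k, ((if k = n then boolSign (ε k) else 1) * (if k = m then boolSign (ε k) else 1)) := by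
      intro ε
      rw [Finset.prod_mul_distrib]
      simp
    simp_rw [h1]
    rw [sum_prod_bool (fun k b => (if k = n then boolSign b else 1) *
      (if k = m then boolSign b else 1))]
    refine Finset.prod_eq_zero (Finset.mem_univ n) ?_
    simp [h]

variable {H : Type*} [NormedAddCommGroup H] [InnerProductSpace ℝ H]

theorem sum_norm_sq_sum_boolSign (v : ι → H) :
    ∑ ε : ι → Bool, ‖∑ n, boolSign (ε n) • v n‖ ^ 2 =
      2 ^ Fintype.card ι * ∑ n, ‖v n‖ ^ 2 := by
  have h : ∀ ε : ι → Bool, ‖∑ n, boolSign (ε n) • v n‖ ^ 2 =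
      ∑ n, ∑ m, boolSign (ε n) * boolSign (ε m) * inner ℝ (v n) (v m) := by
    intro ε
    rw [← real_inner_self_eq_norm_sq, sum_inner]
    refine Finset.sum_congr rfl fun n _ => ?_
    rw [inner_sum]
    refine Finset.sum_congr rfl fun m _ => ?_
    rw [real_inner_smul_left, real_inner_smul_right, mul_assoc]
  simp_rw [h]
  rw [Finset.sum_comm, Finset.mul_sum]
  refine Finset.sum_congr rfl fun n _ => ?_
  rw [Finset.sum_comm]
  simp_rw [← Finset.sum_mul, sum_boolSign_mul, ite_mul, zero_mul]
  simp

/-- Bessel's inequality for the Rademacher functions and a vector-valued function on the cube. -/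
theorem sum_norm_sq_coeff_le (V : (ι → Bool) → H) :
    ∑ n, ‖∑ ε : ι → Bool, boolSign (ε n) • V ε‖ ^ 2 ≤
      2 ^ Fintype.card ι * ∑ ε, ‖V ε‖ ^ 2 := by
  set v : ι → H := fun n => ∑ ε : ι → Bool, boolSign (ε n) • V ε with hv
  set M : ℝ := 2 ^ Fintype.card ι with hM
  have hM0 : 0 < M := by positivity
  have h1 : ∑ n, ‖v n‖ ^ 2 = ∑ ε, inner ℝ (V ε) (∑ n, boolSign (ε n) • v n) := by
    simp_rw [inner_sum]
    rw [Finset.sum_comm]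
    refine Finset.sum_congr rfl fun n _ => ?_
    rw [← real_inner_self_eq_norm_sq]
    conv_lhs => rw [hv]
    rw [sum_inner]
    refine Finset.sum_congr rfl fun ε _ => ?_
    rw [real_inner_smul_left, real_inner_smul_right]
  have h2 : ∀ ε, inner ℝ (V ε) (∑ n, boolSign (ε n) • v n) ≤
      (M * ‖V ε‖ ^ 2 + M⁻¹ * ‖∑ n, boolSign (ε n) • v n‖ ^ 2) / 2 := by
    intro ε
    refine (real_inner_le_norm _ _).trans ?_
    set a := ‖V ε‖
    set b := ‖∑ n, boolSign (ε n) • v n‖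
    have h3 : 0 ≤ M⁻¹ * (M * a - b) ^ 2 := by positivity
    have h4 : M⁻¹ * (M * a - b) ^ 2 = M * a ^ 2 + M⁻¹ * b ^ 2 - 2 * (a * b) := by
      field_simp
      ring
    linarith
  have h5 : ∑ n, ‖v n‖ ^ 2 ≤ (M * ∑ ε, ‖V ε‖ ^ 2 + ∑ n, ‖v n‖ ^ 2) / 2 := by
    calc ∑ n, ‖v n‖ ^ 2 ≤ ∑ ε : ι → Bool,
          (M * ‖V ε‖ ^ 2 + M⁻¹ * ‖∑ n, boolSign (ε n) • v n‖ ^ 2) / 2 := by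
          rw [h1]
          exact Finset.sum_le_sum fun ε _ => h2 ε
      _ = (M * ∑ ε, ‖V ε‖ ^ 2 + ∑ n, ‖v n‖ ^ 2) / 2 := by
          rw [← Finset.sum_div, Finset.sum_add_distrib, ← Finset.mul_sum, ← Finset.mul_sum,
            sum_norm_sq_sum_boolSign, ← mul_assoc, inv_mul_cancel₀ hM0.ne', one_mul]
  linarith

theorem exists_signs_sum_norm_sq_le (v : ι → H) :
    ∃ ε : ι → Bool, ∑ n, ‖v n‖ ^ 2 ≤ ‖∑ n, boolSign (ε n) • v n‖ ^ 2 := by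
  by_contra! h
  have h1 := Finset.sum_lt_sum_of_nonempty (Finset.univ_nonempty (α := ι → Bool))
    fun ε _ => h ε
  rw [sum_norm_sq_sum_boolSign] at h1
  simp at h1

/-- A coefficient is dominated by the average of the modulus of the signed sums. -/
theorem abs_le_sum_abs_sum_boolSign (a : ι → ℝ) (n : ι) :
    2 ^ Fintype.card ι * |a n| ≤ ∑ ε : ι → Bool, |∑ k, boolSign (ε k) * a k| := by
  have h : ∑ ε : ι → Bool, boolSign (ε n) * ∑ k, boolSign (ε k) * a k =
      2 ^ Fintype.card ι * a n := by
    simp_rw [Finset.mul_sum, ← mul_assoc]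
    rw [Finset.sum_comm]
    simp_rw [← Finset.sum_mul, sum_boolSign_mul, ite_mul, zero_mul]
    simp
  calc 2 ^ Fintype.card ι * |a n| = |2 ^ Fintype.card ι * a n| := by
        rw [abs_mul, abs_of_pos (by positivity : (0 : ℝ) < 2 ^ Fintype.card ι)]
    _ ≤ ∑ ε : ι → Bool, |boolSign (ε n) * ∑ k, boolSign (ε k) * a k| := by
        rw [← h]
        exact Finset.abs_sum_le_sum_abs _ _
    _ = _ := by simp_rw [abs_mul, abs_boolSign, one_mul]

/-- The imaginary part of the Riesz product `F ∏ (1 + i εₖ aₖ / F)`. As a function of the signs `ε`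
it is bounded by a multiple of `F` if `∑ aₖ² ≤ F²`, while its Rademacher coefficients are the `aₖ`.
For `F = 0` it vanishes. -/
noncomputable def rieszProduct (F : ℝ) (a : ι → ℝ) (ε : ι → Bool) : ℝ :=
  F * (∏ k, (1 + Complex.I * ((boolSign (ε k) * (a k / F) : ℝ) : ℂ))).im

omit [DecidableEq ι] in
theorem abs_rieszProduct_le {F : ℝ} {a : ι → ℝ} (hF : 0 ≤ F) (h : ∑ k, a k ^ 2 ≤ F ^ 2)
    (ε : ι → Bool) : |rieszProduct F a ε| ≤ Real.exp 1 * F := by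
  rw [rieszProduct, abs_mul, abs_of_nonneg hF, mul_comm]
  refine mul_le_mul_of_nonneg_right ?_ hF
  refine (Complex.abs_im_le_norm _).trans ?_
  rw [← abs_of_nonneg (norm_nonneg _), ← abs_of_pos (Real.exp_pos 1)]
  refine sq_le_sq.1 ?_
  rw [norm_prod, ← Finset.prod_pow]
  have h1 : ∀ k, ‖1 + Complex.I * ((boolSign (ε k) * (a k / F) : ℝ) : ℂ)‖ ^ 2 ≤
      Real.exp ((a k / F) ^ 2) := by
    intro k
    have h2 : ‖1 + Complex.I * ((boolSign (ε k) * (a k / F) : ℝ) : ℂ)‖ ^ 2 =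
        1 + (a k / F) ^ 2 := by
      rw [Complex.sq_norm, Complex.normSq_apply]
      have := boolSign_mul_self (ε k)
      simp
      linear_combination (a k / F) ^ 2 * this
    rw [h2, add_comm]
    exact Real.add_one_le_exp _
  calc ∏ k, ‖1 + Complex.I * ((boolSign (ε k) * (a k / F) : ℝ) : ℂ)‖ ^ 2
      ≤ ∏ k, Real.exp ((a k / F) ^ 2) :=
        Finset.prod_le_prod (fun k _ => by positivity) fun k _ => h1 k
    _ = Real.exp (∑ k, (a k / F) ^ 2) := (Real.exp_sum _ _).symm
    _ ≤ Real.exp 1 ^ 2 := by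
        rw [← Real.exp_nat_mul]
        refine Real.exp_le_exp.2 ?_
        simp_rw [div_pow]
        rw [← Finset.sum_div]
        have := div_le_one_of_le₀ h (sq_nonneg F)
        push_cast
        linarith

theorem sum_boolSign_mul_rieszProduct {F : ℝ} {a : ι → ℝ} (h : ∑ k, a k ^ 2 ≤ F ^ 2) (n : ι) :
    ∑ ε : ι → Bool, boolSign (ε n) * rieszProduct F a ε = 2 ^ Fintype.card ι * a n := by
  have h0 : F = 0 → a n = 0 := by
    intro hF
    have h1 := Finset.single_le_sum (f := fun k => a k ^ 2) (fun k _ => sq_nonneg (a k))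
      (Finset.mem_univ n)
    rw [hF] at h
    have h2 : a n ^ 2 ≤ 0 := by simpa using h1.trans h
    exact pow_eq_zero_iff two_ne_zero |>.1 (le_antisymm h2 (sq_nonneg _))
  have key : ∑ ε : ι → Bool, ((boolSign (ε n) : ℝ) : ℂ) *
      ∏ k, (1 + Complex.I * ((boolSign (ε k) * (a k / F) : ℝ) : ℂ)) =
      2 ^ Fintype.card ι * (Complex.I * ((a n / F : ℝ) : ℂ)) := by
    have h1 : ∀ ε : ι → Bool, ((boolSign (ε n) : ℝ) : ℂ) *
        ∏ k, (1 + Complex.I * ((boolSign (ε k) * (a k / F) : ℝ) : ℂ)) =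
        ∏ k, ((if k = n then ((boolSign (ε k) : ℝ) : ℂ) else 1) *
          (1 + Complex.I * ((boolSign (ε k) * (a k / F) : ℝ) : ℂ))) := by
      intro ε
      rw [Finset.prod_mul_distrib]
      simp
    simp_rw [h1]
    rw [sum_prod_bool (fun k b => (if k = n then ((boolSign b : ℝ) : ℂ) else 1) *
          (1 + Complex.I * ((boolSign b * (a k / F) : ℝ) : ℂ)))]
    have h2 : ∀ k, ((if k = n then ((boolSign true : ℝ) : ℂ) else 1) *
          (1 + Complex.I * ((boolSign true * (a k / F) : ℝ) : ℂ)) +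
        (if k = n then ((boolSign false : ℝ) : ℂ) else 1) *
          (1 + Complex.I * ((boolSign false * (a k / F) : ℝ) : ℂ))) =
        2 * (if k = n then Complex.I * ((a k / F : ℝ) : ℂ) else 1) := by
      intro k
      split_ifs <;> simp <;> ring
    simp_rw [h2]
    rw [Finset.prod_mul_distrib]
    simp
  have h3 := congrArg Complex.im key
  rw [Complex.im_sum] at h3
  simp_rw [Complex.im_ofReal_mul] at h3
  have h4 : ((2 : ℂ) ^ Fintype.card ι * (Complex.I * ((a n / F : ℝ) : ℂ))).im =
      2 ^ Fintype.card ι * (a n / F) := by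
    have : (2 : ℂ) ^ Fintype.card ι = ((2 ^ Fintype.card ι : ℝ) : ℂ) := by push_cast; rfl
    rw [this, Complex.im_ofReal_mul]
    simp
  rw [h4] at h3
  simp_rw [rieszProduct, mul_left_comm _ F]
  rw [← Finset.mul_sum, h3]
  by_cases hF : F = 0
  · simp [hF, h0 hF]
  · field_simp

end Signs

/-! ### Ideal norms and restriction to measurable sets -/

theorem abs_le_abs_of_ae {f g : L0} (h : ∀ᵐ t ∂halfLine, |f t| ≤ |g t|) : |f| ≤ |g| := by
  rw [← AEEqFun.coeFn_le]
  filter_upwards [h, AEEqFun.coeFn_abs f, AEEqFun.coeFn_abs g] with t h1 h2 h3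
  rwa [h2, h3]

/-- The indicator function of a measurable set, as an element of `L0`. -/
noncomputable def ind (A : Set ℝ) (hA : MeasurableSet A) : L0 :=
  AEEqFun.mk (A.indicator fun _ => (1 : ℝ)) (aestronglyMeasurable_const.indicator hA)

theorem coeFn_ind (A : Set ℝ) (hA : MeasurableSet A) :
    ind A hA =ᵐ[halfLine] A.indicator fun _ => (1 : ℝ) :=
  AEEqFun.coeFn_mk _ _

theorem coeFn_ind_mul (A : Set ℝ) (hA : MeasurableSet A) (f : L0) :
    (ind A hA * f : L0) =ᵐ[halfLine] A.indicator f := by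
  filter_upwards [coeFn_ind A hA, AEEqFun.coeFn_mul (ind A hA) f] with t h1 h2
  rw [h2, Pi.mul_apply, h1]
  by_cases ht : t ∈ A <;> simp [ht]

theorem ind_mul_add (A : Set ℝ) (hA : MeasurableSet A) (f g : L0) :
    ind A hA * (f + g) = ind A hA * f + ind A hA * g := by
  refine AEEqFun.ext ?_
  filter_upwards [coeFn_ind_mul A hA (f + g), coeFn_ind_mul A hA f, coeFn_ind_mul A hA g,
    AEEqFun.coeFn_add f g, AEEqFun.coeFn_add (ind A hA * f) (ind A hA * g)] with t h1 h2 h3 h4 h5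
  rw [h1, h5, Pi.add_apply, h2, h3]
  by_cases ht : t ∈ A <;> simp [ht, h4]

theorem ind_mul_smul (A : Set ℝ) (hA : MeasurableSet A) (c : ℝ) (f : L0) :
    ind A hA * (c • f) = c • (ind A hA * f) := by
  refine AEEqFun.ext ?_
  filter_upwards [coeFn_ind_mul A hA (c • f), coeFn_ind_mul A hA f,
    AEEqFun.coeFn_smul c f, AEEqFun.coeFn_smul c (ind A hA * f)] with t h1 h2 h3 h4
  rw [h1, h4, Pi.smul_apply, h2]
  by_cases ht : t ∈ A <;> simp [ht, h3]

namespace ExtNorm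

/-- The norm is monotone with respect to the modulus: its space is an ideal lattice. -/
def IsIdeal (ρ : ExtNorm) : Prop := ∀ f g : L0, |f| ≤ |g| → ρ.toFun f ≤ ρ.toFun g

theorem sum_le (ρ : ExtNorm) {ι : Type*} (s : Finset ι) (f : ι → L0) :
    ρ.toFun (∑ k ∈ s, f k) ≤ ∑ k ∈ s, ρ.toFun (f k) := by
  classical
  induction s using Finset.induction_on with
  | empty => simp [ρ.map_zero]
  | insert a s _ ih =>
    rw [Finset.sum_insert ‹_›, Finset.sum_insert ‹_›]
    exact (ρ.add_le _ _).trans (add_le_add le_rfl ih)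

theorem toFun_coe (ρ : ExtNorm) (f : ρ.space) : ρ.toFun (f : L0) = ENNReal.ofReal ‖f‖ := by
  rw [norm_def, ENNReal.ofReal_toReal f.2]

namespace IsIdeal

variable {ρ : ExtNorm} (hρ : ρ.IsIdeal)

include hρ

theorem le_of_ae {f g : L0} (h : ∀ᵐ t ∂halfLine, |f t| ≤ |g t|) : ρ.toFun f ≤ ρ.toFun g :=
  hρ f g (abs_le_abs_of_ae h)

theorem toFun_abs (f : L0) : ρ.toFun |f| = ρ.toFun f := by
  have h := AEEqFun.coeFn_abs f
  refine le_antisymm (hρ.le_of_ae ?_) (hρ.le_of_ae ?_) <;>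
  · filter_upwards [h] with t ht
    rw [ht, abs_abs]

theorem norm_le_of_ae {f g : ρ.space} (h : ∀ᵐ t ∂halfLine, |(f : L0) t| ≤ |(g : L0) t|) :
    ‖f‖ ≤ ‖g‖ :=
  ENNReal.toReal_mono g.2 (hρ.le_of_ae h)

theorem ind_mul_le (A : Set ℝ) (hA : MeasurableSet A) (f : L0) :
    ρ.toFun (ind A hA * f) ≤ ρ.toFun f := by
  refine hρ.le_of_ae ?_
  filter_upwards [coeFn_ind_mul A hA f] with t h
  rw [h]
  by_cases ht : t ∈ A <;> simp [ht]

/-- Restriction to a measurable set `A`, the map `f ↦ 1_A f`. -/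
noncomputable def cut (A : Set ℝ) (hA : MeasurableSet A) : ρ.space →ₗ[ℝ] ρ.space where
  toFun f := ⟨ind A hA * f, ne_top_of_le_ne_top f.2 (hρ.ind_mul_le A hA f)⟩
  map_add' f g := Subtype.ext (ind_mul_add A hA f g)
  map_smul' c f := Subtype.ext (ind_mul_smul A hA c f)

theorem coeFn_cut (A : Set ℝ) (hA : MeasurableSet A) (f : ρ.space) :
    (hρ.cut A hA f : L0) =ᵐ[halfLine] A.indicator (f : L0) :=
  coeFn_ind_mul A hA f

theorem norm_cut_le (A : Set ℝ) (hA : MeasurableSet A) (f : ρ.space) :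
    ‖hρ.cut A hA f‖ ≤ ‖f‖ :=
  ENNReal.toReal_mono f.2 (hρ.ind_mul_le A hA f)

theorem cut_union {A B : Set ℝ} (hA : MeasurableSet A) (hB : MeasurableSet B)
    (h : Disjoint A B) (f : ρ.space) :
    hρ.cut (A ∪ B) (hA.union hB) f = hρ.cut A hA f + hρ.cut B hB f := by
  refine Subtype.ext (AEEqFun.ext ?_)
  rw [Submodule.coe_add]
  filter_upwards [hρ.coeFn_cut A hA f, hρ.coeFn_cut B hB f, hρ.coeFn_cut _ (hA.union hB) f,
    AEEqFun.coeFn_add (hρ.cut A hA f : L0) (hρ.cut B hB f)] with t h1 h2 h3 h4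
  rw [h3, h4, Pi.add_apply, h1, h2, indicator_union_of_disjoint h]

theorem cut_Ioc_add {a b c : ℝ} (hab : a ≤ b) (hbc : b ≤ c) (f : ρ.space) :
    hρ.cut (Ioc a c) measurableSet_Ioc f =
      hρ.cut (Ioc a b) measurableSet_Ioc f + hρ.cut (Ioc b c) measurableSet_Ioc f := by
  rw [← hρ.cut_union _ _ (Ioc_disjoint_Ioc_of_le le_rfl)]
  simp_rw [Ioc_union_Ioc_eq_Ioc hab hbc]

theorem cut_Ioc_add_cut_Ioi (a : ℝ) (f : ρ.space) :
    hρ.cut (Ioc 0 a) measurableSet_Ioc f + hρ.cut (Ioi a) measurableSet_Ioi f = f := by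
  refine Subtype.ext (AEEqFun.ext ?_)
  rw [Submodule.coe_add]
  filter_upwards [hρ.coeFn_cut (Ioc 0 a) measurableSet_Ioc f,
    hρ.coeFn_cut (Ioi a) measurableSet_Ioi f,
    AEEqFun.coeFn_add (hρ.cut (Ioc 0 a) measurableSet_Ioc f : L0)
      (hρ.cut (Ioi a) measurableSet_Ioi f),
    ae_restrict_mem measurableSet_Ioi] with t h1 h2 h3 h4
  have h5 : (0 : ℝ) < t := h4
  rw [h3, Pi.add_apply, h1, h2]
  by_cases ht : t ≤ a
  · simp [h5, ht]
  · simp [ht, not_le.1 ht]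

/-- **Little Grothendieck theorem** for operators from an ideal lattice into a Hilbert space: the
square function `(∑ fₖ²)^{1/2}` controls `(∑ ‖Q fₖ‖²)^{1/2}`. -/
theorem sum_norm_sq_le {ι : Type*} [Fintype ι] {H : Type*} [NormedAddCommGroup H]
    [InnerProductSpace ℝ H] (Q : ρ.space →L[ℝ] H) (f : ι → ρ.space) (F : ρ.space)
    (hF : ∀ᵐ t ∂halfLine, 0 ≤ (F : L0) t)
    (h : ∀ᵐ t ∂halfLine, ∑ k, ((f k : L0) t) ^ 2 ≤ ((F : L0) t) ^ 2) :
    ∑ k, ‖Q (f k)‖ ^ 2 ≤ (‖Q‖ * (Real.exp 1 * ‖F‖)) ^ 2 := by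
  classical
  have hmeas : ∀ ε : ι → Bool, AEStronglyMeasurable
      (fun t => rieszProduct ((F : L0) t) (fun k => (f k : L0) t) ε) halfLine := by
    intro ε
    refine Measurable.aestronglyMeasurable ?_
    unfold rieszProduct
    have h1 : Measurable ((F : L0) : ℝ → ℝ) := AEEqFun.measurable _
    have h2 : ∀ k, Measurable ((f k : L0) : ℝ → ℝ) := fun k => AEEqFun.measurable _
    refine h1.mul (Complex.measurable_im.comp (Finset.measurable_prod _ fun k _ => ?_))
    exact measurable_const.add (measurable_const.mul
      (Complex.measurable_ofReal.comp (measurable_const.mul ((h2 k).div h1))))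
  let g : (ι → Bool) → L0 := fun ε => AEEqFun.mk _ (hmeas ε)
  have hg : ∀ ε, g ε =ᵐ[halfLine]
      fun t => rieszProduct ((F : L0) t) (fun k => (f k : L0) t) ε :=
    fun ε => AEEqFun.coeFn_mk _ _
  have hgF : ∀ ε, ρ.toFun (g ε) ≤ ρ.toFun (Real.exp 1 • F : ρ.space) := by
    intro ε
    refine hρ.le_of_ae ?_
    filter_upwards [hg ε, hF, h, AEEqFun.coeFn_smul (Real.exp 1) (F : L0)] with t h1 h2 h3 h4
    rw [h1, Submodule.coe_smul, h4, Pi.smul_apply, smul_eq_mul, abs_mul, abs_of_nonneg h2,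
      abs_of_pos (Real.exp_pos 1)]
    exact abs_rieszProduct_le h2 h3 ε
  let G : (ι → Bool) → ρ.space := fun ε =>
    ⟨g ε, ne_top_of_le_ne_top (Real.exp 1 • F : ρ.space).2 (hgF ε)⟩
  have hGn : ∀ ε, ‖Q (G ε)‖ ≤ ‖Q‖ * (Real.exp 1 * ‖F‖) := by
    intro ε
    refine (Q.le_opNorm _).trans (mul_le_mul_of_nonneg_left ?_ (norm_nonneg _))
    have h1 : ‖G ε‖ ≤ ‖Real.exp 1 • F‖ := ENNReal.toReal_mono (Real.exp 1 • F : ρ.space).2 (hgF ε)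
    rwa [norm_smul, Real.norm_eq_abs, abs_of_pos (Real.exp_pos 1)] at h1
  have hGf : ∀ n, ∑ ε, boolSign (ε n) • G ε = (2 : ℝ) ^ Fintype.card ι • f n := by
    intro n
    refine Subtype.ext (AEEqFun.ext ?_)
    rw [AddSubmonoidClass.coe_finsetSum, Submodule.coe_smul]
    simp only [Submodule.coe_smul]
    have h1 : ∀ᵐ t ∂halfLine, ∀ ε : ι → Bool, (boolSign (ε n) • g ε : L0) t =
        boolSign (ε n) * rieszProduct ((F : L0) t) (fun k => (f k : L0) t) ε := by
      rw [ae_all_iff]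
      intro ε
      filter_upwards [hg ε, AEEqFun.coeFn_smul (boolSign (ε n)) (g ε)] with t h2 h3
      rw [h3, Pi.smul_apply, h2, smul_eq_mul]
    filter_upwards [h1, h, AEEqFun.coeFn_smul ((2 : ℝ) ^ Fintype.card ι) (f n : L0),
      AEEqFun.coeFn_finsetSum Finset.univ (fun ε : ι → Bool => (boolSign (ε n) • g ε : L0))]
      with t h2 h3 h4 h5
    rw [h4]
    refine h5.trans ?_
    rw [Finset.sum_apply, Pi.smul_apply, smul_eq_mul, ← sum_boolSign_mul_rieszProduct h3 n]
    exact Finset.sum_congr rfl fun ε _ => h2 ε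
  have hb := sum_norm_sq_coeff_le (fun ε => Q (G ε))
  have hQ : ∀ n, ∑ ε : ι → Bool, boolSign (ε n) • Q (G ε) = (2 : ℝ) ^ Fintype.card ι • Q (f n) := by
    intro n
    rw [← map_smul, ← hGf n, map_sum]
    simp_rw [map_smul]
  simp_rw [hQ, norm_smul, mul_pow] at hb
  rw [← Finset.mul_sum] at hb
  have h6 : ∑ ε : ι → Bool, ‖Q (G ε)‖ ^ 2 ≤
      2 ^ Fintype.card ι * (‖Q‖ * (Real.exp 1 * ‖F‖)) ^ 2 := by
    have := Finset.sum_le_card_nsmul Finset.univ (fun ε : ι → Bool => ‖Q (G ε)‖ ^ 2)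
      ((‖Q‖ * (Real.exp 1 * ‖F‖)) ^ 2)
      fun ε _ => pow_le_pow_left₀ (norm_nonneg _) (hGn ε) 2
    simpa using this
  set M : ℝ := 2 ^ Fintype.card ι with hM
  have hM0 : 0 < M := by positivity
  have h7 : M ^ 2 * ∑ k, ‖Q (f k)‖ ^ 2 ≤ M ^ 2 * (‖Q‖ * (Real.exp 1 * ‖F‖)) ^ 2 := by
    calc M ^ 2 * ∑ k, ‖Q (f k)‖ ^ 2 = ‖M‖ ^ 2 * ∑ k, ‖Q (f k)‖ ^ 2 := by
          rw [Real.norm_eq_abs, sq_abs]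
      _ ≤ M * (M * (‖Q‖ * (Real.exp 1 * ‖F‖)) ^ 2) :=
          hb.trans (mul_le_mul_of_nonneg_left h6 hM0.le)
      _ = _ := by ring
  exact le_of_mul_le_mul_left h7 (by positivity)

end IsIdeal

end ExtNorm

/-! ### Symmetric spaces -/

namespace SymmetricSpace

variable (X : SymmetricSpace)

theorem isIdeal : X.toExtNorm.IsIdeal := X.mono

theorem supNorm_mono {f g : L0} (h : |f| ≤ |g|) : supNorm f ≤ supNorm g := by
  refine eLpNorm_mono_ae ?_
  rw [← AEEqFun.coeFn_le] at h
  filter_upwards [h, AEEqFun.coeFn_abs f, AEEqFun.coeFn_abs g] with t h1 h2 h3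
  rwa [h2, h3] at h1

theorem isIdeal_interLinfty : X.interLinfty.IsIdeal := fun f g h =>
  max_le_max (X.mono f g h) (supNorm_mono h)

theorem ae_abs_le_of_supNorm_le {f : L0} {c : ℝ} (hc : 0 ≤ c)
    (h : supNorm f ≤ ENNReal.ofReal c) : ∀ᵐ t ∂halfLine, |f t| ≤ c := by
  have h1 := ae_le_eLpNormEssSup (f := f) (μ := halfLine)
  rw [supNorm, eLpNorm_exponent_top] at h
  filter_upwards [h1] with t ht
  have h2 := ht.trans h
  rw [Real.enorm_eq_ofReal_abs] at h2
  exact (ENNReal.ofReal_le_ofReal_iff hc).1 h2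

theorem supNorm_le_of_ae {f : L0} {c : ℝ} (h : ∀ᵐ t ∂halfLine, |f t| ≤ c) :
    supNorm f ≤ ENNReal.ofReal c := by
  rw [supNorm, eLpNorm_exponent_top]
  refine eLpNormEssSup_le_of_ae_enorm_bound ?_
  filter_upwards [h] with t ht
  rw [Real.enorm_eq_ofReal_abs]
  exact ENNReal.ofReal_le_ofReal ht

theorem ae_abs_le_norm (f : X.interLinfty.space) : ∀ᵐ t ∂halfLine, |(f : L0) t| ≤ ‖f‖ := by
  refine ae_abs_le_of_supNorm_le (norm_nonneg _) ?_
  rw [← ExtNorm.toFun_coe]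
  exact le_max_right _ _

/-- The inclusion of `X ∩ L_∞` into `X`. -/
noncomputable def toX : X.interLinfty.space →ₗ[ℝ] X.space :=
  Submodule.inclusion fun f hf => ne_top_of_le_ne_top (b := X.interLinfty.toFun f) hf
    (le_max_left _ _)

@[simp] theorem coe_toX (f : X.interLinfty.space) : (X.toX f : L0) = f := rfl

theorem norm_toX_le (f : X.interLinfty.space) : ‖X.toX f‖ ≤ ‖f‖ :=
  ENNReal.toReal_mono f.2 (le_max_left _ _)

theorem norm_interLinfty_le {f : X.interLinfty.space} {c : ℝ} (h : ‖X.toX f‖ ≤ c)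
    (h' : ∀ᵐ t ∂halfLine, |(f : L0) t| ≤ c) : ‖f‖ ≤ c := by
  refine ENNReal.toReal_le_of_le_ofReal ((norm_nonneg _).trans h) (max_le ?_ (supNorm_le_of_ae h'))
  change X.toFun (X.toX f : L0) ≤ _
  rw [X.toFun_coe]
  exact ENNReal.ofReal_le_ofReal h

end SymmetricSpace

/-! ### Indicators and order continuity in a symmetric space -/

namespace SymmetricSpace

variable (X : SymmetricSpace)

theorem toFun_ind_mono {A B : Set ℝ} (hA : MeasurableSet A) (hB : MeasurableSet B)
    (h : ∀ t, 0 < t → t ∈ A → t ∈ B) : X.toFun (ind A hA) ≤ X.toFun (ind B hB) := by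
  refine X.isIdeal.le_of_ae ?_
  filter_upwards [coeFn_ind A hA, coeFn_ind B hB, ae_restrict_mem measurableSet_Ioi]
    with t h1 h2 h3
  rw [h1, h2]
  by_cases ht : t ∈ A
  · simp [ht, h t h3 ht]
  · simp [ht]

/-- Sets of the same measure have indicators of the same norm. -/
theorem toFun_ind_congr {A B : Set ℝ} (hA : MeasurableSet A) (hB : MeasurableSet B)
    (h : halfLine A = halfLine B) : X.toFun (ind A hA) = X.toFun (ind B hB) := by
  have key : ∀ (S : Set ℝ) (hS : MeasurableSet S) (τ : ℝ), 0 < τ →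
      halfLine {t | τ < |ind S hS t|} = if τ < 1 then halfLine S else 0 := by
    intro S hS τ hτ
    have h1 : halfLine {t | τ < |ind S hS t|} =
        halfLine (if τ < 1 then S else ∅) := by
      refine measure_congr ?_
      filter_upwards [coeFn_ind S hS] with t ht
      refine propext ?_
      change τ < |ind S hS t| ↔ t ∈ (if τ < 1 then S else ∅)
      rw [ht]
      by_cases hts : t ∈ S <;> by_cases hτ1 : τ < 1 <;> simp [hts, hτ1, hτ.le]
    rw [h1]
    split_ifs <;> simp
  refine X.equimeasurable _ _ fun τ hτ => ?_
  rw [key A hA τ hτ, key B hB τ hτ, h]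

theorem halfLine_Ioc {a b : ℝ} (ha : 0 ≤ a) : halfLine (Ioc a b) = ENNReal.ofReal (b - a) := by
  rw [Measure.restrict_apply measurableSet_Ioc, inter_eq_left.2, Real.volume_Ioc]
  exact fun t ht => ha.trans_lt ht.1

theorem exists_toFun_ind_ne_top : ∃ (B : Set ℝ) (hB : MeasurableSet B),
    halfLine B ≠ 0 ∧ halfLine B ≠ ∞ ∧ X.toFun (ind B hB) ≠ ∞ := by
  obtain ⟨f, hf0, hf⟩ := X.nontrivial
  obtain ⟨n, hn⟩ : ∃ n : ℕ, halfLine ({t | (1 : ℝ) / (n + 1) < |f t|} ∩ Ioc 0 (n : ℝ)) ≠ 0 := by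
    by_contra! h
    refine hf0 (AEEqFun.ext ?_)
    have h' : ∀ᵐ t ∂halfLine, ∀ n : ℕ, t ∉ {t | (1 : ℝ) / (n + 1) < |f t|} ∩ Ioc 0 (n : ℝ) := by
      rw [ae_all_iff]
      exact fun n => measure_eq_zero_iff_ae_notMem.1 (h n)
    filter_upwards [h', AEEqFun.coeFn_zero (α := ℝ) (β := ℝ) (μ := halfLine),
      ae_restrict_mem measurableSet_Ioi] with t ht h0 ht0
    rw [h0]
    by_contra hft
    obtain ⟨n, hn⟩ := exists_nat_one_div_lt (abs_pos.2 hft)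
    obtain ⟨m, hm⟩ := exists_nat_ge t
    refine ht (max n m) ⟨?_, ht0, hm.trans (by exact_mod_cast le_max_right n m)⟩
    refine lt_of_le_of_lt ?_ hn
    refine one_div_le_one_div_of_le (by positivity) ?_
    have : (n : ℝ) ≤ (max n m : ℕ) := by exact_mod_cast le_max_left n m
    linarith
  set δ : ℝ := 1 / (n + 1) with hδ
  have hδ0 : 0 < δ := by positivity
  have hBm : MeasurableSet ({t | δ < |f t|} ∩ Ioc 0 (n : ℝ)) :=
    (measurableSet_lt measurable_const (AEEqFun.measurable f).abs).inter measurableSet_Ioc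
  refine ⟨_, hBm, hn, ?_, ?_⟩
  · refine ne_top_of_le_ne_top ?_ (measure_mono inter_subset_right)
    rw [halfLine_Ioc le_rfl]
    exact ENNReal.ofReal_ne_top
  · have h1 : X.toFun (δ • ind _ hBm) ≤ X.toFun f := by
      refine X.isIdeal.le_of_ae ?_
      filter_upwards [coeFn_ind _ hBm, AEEqFun.coeFn_smul δ (ind _ hBm)] with t h2 h3
      rw [h3, Pi.smul_apply, h2]
      by_cases ht : t ∈ {t | δ < |f t|} ∩ Ioc 0 (n : ℝ)
      · rw [indicator_of_mem ht, smul_eq_mul, mul_one, abs_of_pos hδ0]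
        exact (show δ < |f t| from ht.1).le
      · simp [indicator_of_notMem ht]
    rw [X.smul] at h1
    intro htop
    rw [htop, ENNReal.mul_top (by simpa using hδ0.ne')] at h1
    exact hf (top_le_iff.1 h1)

theorem toFun_ind_Ioc_ne_top (b : ℝ) : X.toFun (ind (Ioc 0 b) measurableSet_Ioc) ≠ ∞ := by
  obtain ⟨B, hB, hB0, hBt, hBX⟩ := X.exists_toFun_ind_ne_top
  set r : ℝ := (halfLine B).toReal with hr
  have hr0 : 0 < r := ENNReal.toReal_pos hB0 hBt
  have h1 : ∀ a : ℝ, 0 ≤ a → X.toFun (ind (Ioc a (a + r)) measurableSet_Ioc) ≠ ∞ := by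
    intro a ha
    rw [X.toFun_ind_congr measurableSet_Ioc hB]
    · exact hBX
    · rw [halfLine_Ioc ha, add_sub_cancel_left, hr, ENNReal.ofReal_toReal hBt]
  have h2 : ∀ n : ℕ, X.toFun (ind (Ioc 0 (n * r)) measurableSet_Ioc) ≠ ∞ := by
    intro n
    induction n with
    | zero =>
      refine ne_top_of_le_ne_top (h1 0 le_rfl) (X.toFun_ind_mono _ _ fun t _ ht => ?_)
      exact ⟨ht.1, ht.2.trans (by simpa using hr0.le)⟩
    | succ n ih =>
      have hn0 : 0 ≤ n * r := by positivity
      have h3 : ind (Ioc 0 ((n + 1 : ℕ) * r)) measurableSet_Ioc =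
          ind (Ioc 0 (n * r)) measurableSet_Ioc +
            ind (Ioc (n * r) (n * r + r)) measurableSet_Ioc := by
        refine AEEqFun.ext ?_
        filter_upwards [coeFn_ind (Ioc 0 ((n + 1 : ℕ) * r)) measurableSet_Ioc,
          coeFn_ind (Ioc 0 (n * r)) measurableSet_Ioc,
          coeFn_ind (Ioc (n * r) (n * r + r)) measurableSet_Ioc,
          AEEqFun.coeFn_add (ind (Ioc 0 (n * r)) measurableSet_Ioc)
            (ind (Ioc (n * r) (n * r + r)) measurableSet_Ioc)] with t h4 h5 h6 h7
        have h8 : ((n + 1 : ℕ) * r : ℝ) = n * r + r := by push_cast; ring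
        rw [h7, Pi.add_apply, h4, h5, h6, h8,
          ← Ioc_union_Ioc_eq_Ioc hn0 (by linarith : n * r ≤ n * r + r),
          indicator_union_of_disjoint (Ioc_disjoint_Ioc_of_le le_rfl)]
      rw [h3]
      exact ne_top_of_le_ne_top (ENNReal.add_ne_top.2 ⟨ih, h1 _ hn0⟩) (X.add_le _ _)
  obtain ⟨n, hn⟩ := exists_nat_ge (b / r)
  refine ne_top_of_le_ne_top (h2 n) (X.toFun_ind_mono _ _ fun t _ ht => ⟨ht.1, ht.2.trans ?_⟩)
  exact (div_le_iff₀ hr0).1 hn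

/-- In a separable symmetric space the truncations of a function form a Cauchy sequence: otherwise
the function has infinitely many disjoint pieces of norm at least `δ`, and the sums over different
sets of pieces form an uncountable `δ`-separated set. -/
theorem cauchySeq_cut_Ioc (hsep : TopologicalSpace.SeparableSpace X.space) (f : X.space) :
    CauchySeq fun m : ℕ => X.isIdeal.cut (Ioc 0 (m : ℝ)) measurableSet_Ioc f := by
  set u : ℕ → X.space := fun m => X.isIdeal.cut (Ioc 0 (m : ℝ)) measurableSet_Ioc f with hu
  by_contra hc
  rw [Metric.cauchySeq_iff'] at hc
  push Not at hc
  obtain ⟨δ, hδ, hc⟩ := hc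
  choose g hg hgδ using hc
  have hglt : ∀ N, N < g N := by
    intro N
    refine lt_of_le_of_ne (hg N) fun h => ?_
    have h1 := hgδ N
    rw [← h, dist_self] at h1
    linarith
  let m : ℕ → ℕ := fun k => g^[k] 0
  have hm : ∀ k, m (k + 1) = g (m k) := fun k => Function.iterate_succ_apply' g k 0
  have hmono : StrictMono m := strictMono_nat_of_lt_succ fun k => by rw [hm]; exact hglt _
  let D : ℕ → Set ℝ := fun k => Ioc (m k : ℝ) (m (k + 1) : ℝ)
  have hDm : ∀ k, MeasurableSet (D k) := fun k => measurableSet_Ioc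
  have hDdisj : ∀ j k, j < k → Disjoint (D j) (D k) := fun j k hjk =>
    Ioc_disjoint_Ioc_of_le (by exact_mod_cast hmono.monotone (Nat.succ_le_of_lt hjk))
  have hDdisj' : ∀ j k, j ≠ k → Disjoint (D j) (D k) := fun j k hjk =>
    (lt_or_gt_of_ne hjk).elim (hDdisj j k) fun h => (hDdisj k j h).symm
  have hDδ : ∀ k, δ ≤ ‖X.isIdeal.cut (D k) (hDm k) f‖ := by
    intro k
    have h1 := hgδ (m k)
    rw [← hm, dist_eq_norm] at h1
    have h2 := X.isIdeal.cut_Ioc_add (Nat.cast_nonneg (m k) : (0 : ℝ) ≤ m k)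
      (by exact_mod_cast (hmono (Nat.lt_succ_self k)).le : (m k : ℝ) ≤ m (k + 1)) f
    simp only [hu] at h1
    rwa [h2, add_sub_cancel_left] at h1
  have hUm : ∀ S : Set ℕ, MeasurableSet (⋃ k ∈ S, D k) := fun S =>
    MeasurableSet.biUnion (to_countable S) fun k _ => hDm k
  let w : Set ℕ → X.space := fun S => X.isIdeal.cut (⋃ k ∈ S, D k) (hUm S) f
  have hmem : ∀ (S : Set ℕ) (k : ℕ) (t : ℝ), t ∈ D k → (t ∈ (⋃ k ∈ S, D k) ↔ k ∈ S) := by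
    intro S k t ht
    simp only [mem_iUnion, exists_prop]
    constructor
    · rintro ⟨j, hj, htj⟩
      by_contra hk
      exact disjoint_left.1 (hDdisj' j k fun h => hk (h ▸ hj)) htj ht
    · exact fun hk => ⟨k, hk, ht⟩
  have hsepd : ∀ (S S' : Set ℕ) (k : ℕ), k ∈ S → k ∉ S' → δ ≤ dist (w S) (w S') := by
    intro S S' k hk hk'
    rw [dist_eq_norm]
    refine (hDδ k).trans (X.isIdeal.norm_le_of_ae ?_)
    rw [Submodule.coe_sub]
    filter_upwards [X.isIdeal.coeFn_cut _ (hDm k) f, X.isIdeal.coeFn_cut _ (hUm S) f,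
      X.isIdeal.coeFn_cut _ (hUm S') f, AEEqFun.coeFn_sub (w S : L0) (w S')] with t h1 h2 h3 h4
    rw [h1, h4, Pi.sub_apply, h2, h3]
    by_cases ht : t ∈ D k
    · rw [indicator_of_mem ht, indicator_of_mem ((hmem S k t ht).2 hk),
        indicator_of_notMem (fun h => hk' ((hmem S' k t ht).1 h)), sub_zero]
    · simp [indicator_of_notMem ht]
  have hsepd' : ∀ S S' : Set ℕ, S ≠ S' → δ ≤ dist (w S) (w S') := by
    intro S S' h
    by_cases h1 : S ⊆ S'
    · obtain ⟨k, hk, hk'⟩ := not_subset.1 fun h2 => h (h1.antisymm h2)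
      rw [dist_comm]
      exact hsepd _ _ k hk hk'
    · obtain ⟨k, hk, hk'⟩ := not_subset.1 h1
      exact hsepd _ _ k hk hk'
  have hcount : Countable (Set ℕ) := by
    refine Pairwise.countable_of_isOpen_disjoint (s := fun S => Metric.ball (w S) (δ / 2))
      (fun S S' h => ?_) (fun S => Metric.isOpen_ball)
      fun S => ⟨w S, Metric.mem_ball_self (by positivity)⟩
    exact Metric.ball_disjoint_ball (by linarith [hsepd' S S' h])
  obtain ⟨φ, hφ⟩ := hcount.exists_injective_nat
  exact Function.cantor_injective φ hφ

theorem tendsto_norm_cut_Ioi (hsep : TopologicalSpace.SeparableSpace X.space) (f : X.space) :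
    Filter.Tendsto (fun m : ℕ => ‖X.isIdeal.cut (Ioi (m : ℝ)) measurableSet_Ioi f‖)
      Filter.atTop (nhds 0) := by
  have := X.complete
  obtain ⟨g, hg⟩ := cauchySeq_tendsto_of_complete (X.cauchySeq_cut_Ioc hsep f)
  have hgf : g = f := by
    have h1 : ∀ m : ℕ, X.isIdeal.cut (Ioc 0 (m : ℝ)) measurableSet_Ioc (g - f) = 0 := by
      intro m
      have h2 : ∀ n, m ≤ n → ‖X.isIdeal.cut (Ioc 0 (m : ℝ)) measurableSet_Ioc (g - f)‖ ≤
          ‖g - X.isIdeal.cut (Ioc 0 (n : ℝ)) measurableSet_Ioc f‖ := by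
        intro n hmn
        refine X.isIdeal.norm_le_of_ae ?_
        rw [Submodule.coe_sub]
        filter_upwards [X.isIdeal.coeFn_cut (Ioc 0 (m : ℝ)) measurableSet_Ioc (g - f),
          X.isIdeal.coeFn_cut (Ioc 0 (n : ℝ)) measurableSet_Ioc f,
          AEEqFun.coeFn_sub (g : L0) f, AEEqFun.coeFn_sub (g : L0)
            (X.isIdeal.cut (Ioc 0 (n : ℝ)) measurableSet_Ioc f)] with t h3 h4 h5 h6
        rw [h3, h6, Pi.sub_apply, h4]
        by_cases ht : t ∈ Ioc 0 (m : ℝ)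
        · have ht' : t ∈ Ioc 0 (n : ℝ) := ⟨ht.1, ht.2.trans (by exact_mod_cast hmn)⟩
          rw [indicator_of_mem ht, indicator_of_mem ht', Submodule.coe_sub, h5, Pi.sub_apply]
        · simp [indicator_of_notMem ht]
      have h3 : Filter.Tendsto
          (fun n : ℕ => ‖g - X.isIdeal.cut (Ioc 0 (n : ℝ)) measurableSet_Ioc f‖)
          Filter.atTop (nhds 0) := by
        have := (tendsto_const_nhds (x := g)).sub hg |>.norm
        simpa using this
      refine norm_le_zero_iff.1 (ge_of_tendsto h3 ?_)
      filter_upwards [Filter.eventually_ge_atTop m] with n hn using h2 n hn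
    refine sub_eq_zero.1 (Subtype.ext (AEEqFun.ext ?_))
    have h2 : ∀ᵐ t ∂halfLine, ∀ m : ℕ, t ∈ Ioc 0 (m : ℝ) → (g - f : X.space).1 t = 0 := by
      rw [ae_all_iff]
      intro m
      have h3 := X.isIdeal.coeFn_cut (Ioc 0 (m : ℝ)) measurableSet_Ioc (g - f)
      rw [h1 m] at h3
      filter_upwards [h3, AEEqFun.coeFn_zero (α := ℝ) (β := ℝ) (μ := halfLine)] with t h4 h5 ht
      rw [indicator_of_mem ht] at h4
      exact h4.symm.trans h5
    filter_upwards [h2, ae_restrict_mem measurableSet_Ioi,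
      AEEqFun.coeFn_zero (α := ℝ) (β := ℝ) (μ := halfLine)] with t h3 h4 h5
    obtain ⟨m, hm⟩ := exists_nat_ge t
    exact (h3 m ⟨h4, hm⟩).trans h5.symm
  have h1 := ((tendsto_const_nhds (x := g)).sub hg).norm
  rw [sub_self, norm_zero, hgf] at h1
  exact h1.congr fun m =>
    congrArg norm (sub_eq_of_eq_add' (X.isIdeal.cut_Ioc_add_cut_Ioi (m : ℝ) f).symm)

end SymmetricSpace

/-! ### Disjoint pieces of a copy of `l_2` in `X ∩ L_∞` -/

theorem finite_of_card_le {A : Set ℕ} {K : ℝ}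
    (h : ∀ s : Finset ℕ, (s : Set ℕ) ⊆ A → (s.card : ℝ) ≤ K) : A.Finite := by
  by_contra hA
  obtain ⟨n, hn⟩ := exists_nat_gt K
  obtain ⟨s, hs, hsn⟩ := Set.Infinite.exists_subset_card_eq hA n
  have := h s hs
  rw [hsn] at this
  linarith

namespace SymmetricSpace

variable (X : SymmetricSpace)

/-- The square function of a family that satisfies an upper `l_2`-estimate is bounded. -/
theorem ae_sum_sq_le {ι : Type*} [Fintype ι] (x : ι → X.interLinfty.space) {C : ℝ}
    (h : ∀ a : ι → ℝ, ‖∑ k, a k • x k‖ ≤ C * √(∑ k, a k ^ 2)) :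
    ∀ᵐ t ∂halfLine, ∑ k, ((x k : L0) t) ^ 2 ≤ C ^ 2 := by
  have h1 : ∀ᵐ t ∂halfLine, ∀ j : ℕ,
      |∑ k, TopologicalSpace.denseSeq (ι → ℝ) j k * (x k : L0) t| ≤
        C * √(∑ k, TopologicalSpace.denseSeq (ι → ℝ) j k ^ 2) := by
    rw [ae_all_iff]
    intro j
    set a := TopologicalSpace.denseSeq (ι → ℝ) j
    have h2 : ∀ᵐ t ∂halfLine, ∀ k, (a k • (x k : L0) : L0) t = a k * (x k : L0) t := by
      rw [ae_all_iff]
      intro k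
      filter_upwards [AEEqFun.coeFn_smul (a k) (x k : L0)] with t ht
      rw [ht, Pi.smul_apply, smul_eq_mul]
    filter_upwards [X.ae_abs_le_norm (∑ k, a k • x k), h2,
      AEEqFun.coeFn_finsetSum Finset.univ fun k => (a k • (x k : L0) : L0)] with t h3 h4 h5
    rw [AddSubmonoidClass.coe_finsetSum] at h3
    have h6 : (∑ k, (a k • (x k : L0)) : L0) t = ∑ k, a k * (x k : L0) t := by
      refine h5.trans ?_
      rw [Finset.sum_apply]
      exact Finset.sum_congr rfl fun k _ => h4 k
    simp only [Submodule.coe_smul] at h3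
    rw [h6] at h3
    exact h3.trans (h a)
  filter_upwards [h1] with t ht
  have hclosed : IsClosed {a : ι → ℝ | |∑ k, a k * (x k : L0) t| ≤ C * √(∑ k, a k ^ 2)} :=
    isClosed_le (by fun_prop) (by fun_prop)
  have hall : ∀ a : ι → ℝ, |∑ k, a k * (x k : L0) t| ≤ C * √(∑ k, a k ^ 2) := by
    intro a
    have h2 : closure (range (TopologicalSpace.denseSeq (ι → ℝ))) ⊆
        {a : ι → ℝ | |∑ k, a k * (x k : L0) t| ≤ C * √(∑ k, a k ^ 2)} :=
      closure_minimal (by rintro _ ⟨j, rfl⟩; exact ht j) hclosed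
    rw [(TopologicalSpace.denseRange_denseSeq (ι → ℝ)).closure_range] at h2
    exact h2 (mem_univ a)
  have h3 := hall fun k => (x k : L0) t
  simp_rw [← pow_two] at h3
  set S := ∑ k, ((x k : L0) t) ^ 2
  have hS : 0 ≤ S := Finset.sum_nonneg fun k _ => sq_nonneg _
  rw [abs_of_nonneg hS] at h3
  have h4 : S * S ≤ C ^ 2 * S := by
    calc S * S ≤ (C * √S) * (C * √S) := mul_self_le_mul_self hS h3
      _ = C ^ 2 * (√S * √S) := by ring
      _ = C ^ 2 * S := by rw [Real.mul_self_sqrt hS]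
  by_contra hlt
  push Not at hlt
  nlinarith [sq_nonneg C]

theorem ae_sum_sq_le_finset {x : ℕ → X.interLinfty.space} {C : ℝ}
    (hx : ∀ (s : Finset ℕ) (a : ℕ → ℝ), ‖∑ k ∈ s, a k • x k‖ ≤ C * √(∑ k ∈ s, a k ^ 2))
    (s : Finset ℕ) : ∀ᵐ t ∂halfLine, ∑ k : s, ((x k : L0) t) ^ 2 ≤ C ^ 2 := by
  refine X.ae_sum_sq_le (fun k : s => x k) fun a => ?_
  have h := hx s fun k => if hk : k ∈ s then a ⟨k, hk⟩ else 0
  rw [← Finset.sum_coe_sort s fun k => (if hk : k ∈ s then a ⟨k, hk⟩ else 0) • x k,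
    ← Finset.sum_coe_sort s fun k => (if hk : k ∈ s then a ⟨k, hk⟩ else 0) ^ 2] at h
  simpa using h

section Pieces

variable {H : Type*} [NormedAddCommGroup H] [InnerProductSpace ℝ H]
  (Q : X.interLinfty.space →L[ℝ] H) {x : ℕ → X.interLinfty.space} {C : ℝ}

/-- On a bounded interval `X ∩ L_∞` is `L_∞`, so `Q` restricted to it is `2`-summing. -/
theorem exists_sum_norm_sq_cut_Ioc_le
    (hx : ∀ (s : Finset ℕ) (a : ℕ → ℝ), ‖∑ k ∈ s, a k • x k‖ ≤ C * √(∑ k ∈ s, a k ^ 2))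
    (hC : 0 ≤ C) (b : ℝ) :
    ∃ K : ℝ, ∀ s : Finset ℕ,
      ∑ k ∈ s, ‖Q (X.isIdeal_interLinfty.cut (Ioc 0 b) measurableSet_Ioc (x k))‖ ^ 2 ≤ K := by
  have hχ : X.interLinfty.toFun (ind (Ioc 0 b) measurableSet_Ioc) ≠ ∞ := by
    refine (max_lt (lt_top_iff_ne_top.2 (X.toFun_ind_Ioc_ne_top b)) ?_).ne
    refine (supNorm_le_of_ae (c := 1) ?_).trans_lt ENNReal.ofReal_lt_top
    filter_upwards [coeFn_ind (Ioc 0 b) measurableSet_Ioc] with t ht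
    rw [ht]
    by_cases h : t ∈ Ioc 0 b <;> simp [h]
  let χ : X.interLinfty.space := ⟨ind (Ioc 0 b) measurableSet_Ioc, hχ⟩
  have hF : ∀ᵐ t ∂halfLine, ((C • χ : X.interLinfty.space) : L0) t =
      (Ioc 0 b).indicator (fun _ => C) t := by
    rw [Submodule.coe_smul]
    filter_upwards [AEEqFun.coeFn_smul C (χ : L0), coeFn_ind (Ioc 0 b) measurableSet_Ioc]
      with t h1 h2
    rw [h1, Pi.smul_apply, h2]
    by_cases h : t ∈ Ioc 0 b <;> simp [h]
  refine ⟨(‖Q‖ * (Real.exp 1 * ‖C • χ‖)) ^ 2, fun s => ?_⟩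
  rw [← Finset.sum_coe_sort]
  refine X.isIdeal_interLinfty.sum_norm_sq_le Q
    (fun k : s => X.isIdeal_interLinfty.cut (Ioc 0 b) measurableSet_Ioc (x k)) (C • χ) ?_ ?_
  · filter_upwards [hF] with t ht
    rw [ht]
    by_cases h : t ∈ Ioc 0 b <;> simp [h, hC]
  · have h1 : ∀ᵐ t ∂halfLine, ∀ k : s,
        (X.isIdeal_interLinfty.cut (Ioc 0 b) measurableSet_Ioc (x k) : L0) t =
          (Ioc 0 b).indicator (x k : L0) t := by
      rw [ae_all_iff]
      exact fun k => X.isIdeal_interLinfty.coeFn_cut _ _ _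
    have h2 := X.ae_sum_sq_le_finset hx s
    filter_upwards [hF, h1, h2] with t h3 h4 h5
    simp_rw [h3, h4]
    by_cases h : t ∈ Ioc 0 b
    · simpa [indicator_of_mem h] using h5
    · simp [indicator_of_notMem h]

/-- Finitely many functions have tails that are small in `X`, so that the norm of `X ∩ L_∞` is on
them the norm of `L_∞`, and `Q` is `2`-summing with a constant that does not depend on their
number. -/
theorem eventually_sum_norm_sq_cut_Ioi_le (hsep : TopologicalSpace.SeparableSpace X.space)
    (hx : ∀ (s : Finset ℕ) (a : ℕ → ℝ), ‖∑ k ∈ s, a k • x k‖ ≤ C * √(∑ k ∈ s, a k ^ 2))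
    (hC : 0 < C) (s : Finset ℕ) :
    ∀ᶠ m : ℕ in Filter.atTop,
      ∑ k ∈ s, ‖Q (X.isIdeal_interLinfty.cut (Ioi (m : ℝ)) measurableSet_Ioi (x k))‖ ^ 2 ≤
        (‖Q‖ * (Real.exp 1 * C)) ^ 2 := by
  have hlim : Filter.Tendsto (fun m : ℕ => ∑ k ∈ s,
      ‖X.isIdeal.cut (Ioi (m : ℝ)) measurableSet_Ioi (X.toX (x k))‖) Filter.atTop (nhds 0) := by
    simpa using tendsto_finsetSum s fun k _ => X.tendsto_norm_cut_Ioi hsep (X.toX (x k))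
  filter_upwards [hlim.eventually_lt_const hC] with m hm
  let f : ℕ → X.interLinfty.space := fun k =>
    X.isIdeal_interLinfty.cut (Ioi (m : ℝ)) measurableSet_Ioi (x k)
  -- the majorant `min (C, ∑ |fₖ|)` of the square function is small in `X` and bounded by `C`
  let G : L0 := ∑ k ∈ s, |(f k : L0)|
  let F : L0 := AEEqFun.mk (fun t => min C (G t))
    (aestronglyMeasurable_const.inf G.aestronglyMeasurable)
  have hF : F =ᵐ[halfLine] fun t => min C (G t) := AEEqFun.coeFn_mk _ _
  have hG : ∀ᵐ t ∂halfLine, G t = ∑ k ∈ s, |(f k : L0) t| := by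
    have h1 : ∀ᵐ t ∂halfLine, ∀ k, |(f k : L0)| t = |(f k : L0) t| := by
      rw [ae_all_iff]
      exact fun k => AEEqFun.coeFn_abs _
    filter_upwards [h1, AEEqFun.coeFn_finsetSum s fun k => |(f k : L0)|] with t h2 h3
    refine h3.trans ?_
    rw [Finset.sum_apply]
    exact Finset.sum_congr rfl fun k _ => h2 k
  have hG0 : ∀ᵐ t ∂halfLine, 0 ≤ G t := by
    filter_upwards [hG] with t ht
    rw [ht]
    exact Finset.sum_nonneg fun k _ => abs_nonneg _
  have hFX : X.toFun F ≤ ENNReal.ofReal C := by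
    calc X.toFun F ≤ X.toFun G := by
          refine X.isIdeal.le_of_ae ?_
          filter_upwards [hF, hG0] with t h1 h2
          rw [h1, abs_of_nonneg (le_min hC.le h2), abs_of_nonneg h2]
          exact min_le_right _ _
      _ ≤ ∑ k ∈ s, X.toFun |(f k : L0)| := X.toExtNorm.sum_le s _
      _ = ∑ k ∈ s, ENNReal.ofReal
            ‖X.isIdeal.cut (Ioi (m : ℝ)) measurableSet_Ioi (X.toX (x k))‖ := by
          refine Finset.sum_congr rfl fun k _ => ?_
          rw [X.isIdeal.toFun_abs, ← X.toFun_coe]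
          rfl
      _ ≤ ENNReal.ofReal C := by
          rw [← ENNReal.ofReal_sum_of_nonneg fun k _ => norm_nonneg _]
          exact ENNReal.ofReal_le_ofReal hm.le
  have hFE : X.interLinfty.toFun F ≤ ENNReal.ofReal C := by
    refine max_le hFX (supNorm_le_of_ae ?_)
    filter_upwards [hF, hG0] with t h1 h2
    rw [h1, abs_of_nonneg (le_min hC.le h2)]
    exact min_le_left _ _
  let F' : X.interLinfty.space := ⟨F, ne_top_of_le_ne_top ENNReal.ofReal_ne_top hFE⟩
  have hF' : ‖F'‖ ≤ C := ENNReal.toReal_le_of_le_ofReal hC.le hFE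
  rw [← Finset.sum_coe_sort]
  refine (X.isIdeal_interLinfty.sum_norm_sq_le Q (fun k : s => f k) F' ?_ ?_).trans ?_
  · filter_upwards [hF, hG0] with t h1 h2
    change 0 ≤ F t
    rw [h1]
    exact le_min hC.le h2
  · have h1 : ∀ᵐ t ∂halfLine, ∀ k : s, (f k : L0) t = (Ioi (m : ℝ)).indicator (x k : L0) t := by
      rw [ae_all_iff]
      exact fun k => X.isIdeal_interLinfty.coeFn_cut _ _ _
    have h2 := X.ae_sum_sq_le_finset hx s
    filter_upwards [hF, hG, h1, h2] with t h3 h4 h5 h6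
    change _ ≤ (F t) ^ 2
    rw [h3]
    rw [← Finset.sum_coe_sort] at h4
    have h7 : ∑ k : s, ((f k : L0) t) ^ 2 ≤ C ^ 2 := by
      refine le_trans (Finset.sum_le_sum fun k _ => ?_) h6
      rw [h5 k]
      by_cases h : t ∈ Ioi (m : ℝ)
      · simp [indicator_of_mem h]
      · rw [indicator_of_notMem h, zero_pow two_ne_zero]
        exact sq_nonneg _
    have h8 : ∑ k : s, ((f k : L0) t) ^ 2 ≤ (G t) ^ 2 := by
      rw [h4]
      have := Finset.sum_sq_le_sq_sum_of_nonneg (s := Finset.univ)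
        (f := fun k : s => |(f k : L0) t|) fun k _ => abs_nonneg _
      simpa using this
    rcases min_choice C (G t) with h9 | h9 <;> rw [h9]
    · exact h7
    · exact h8
  · gcongr

/-- One step of the gliding hump: beyond any bounds there are an index `n` and an interval that
carries a substantial part of `Q (x n)`. -/
theorem exists_cut_Ioc_norm_ge (hsep : TopologicalSpace.SeparableSpace X.space)
    (hx : ∀ (s : Finset ℕ) (a : ℕ → ℝ), ‖∑ k ∈ s, a k • x k‖ ≤ C * √(∑ k ∈ s, a k ^ 2))
    (hC : 0 < C) (hQ : ∀ n, 1 ≤ ‖Q (x n)‖) (m₀ n₀ : ℕ) :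
    ∃ n m : ℕ, n₀ < n ∧ m₀ ≤ m ∧
      1 / 4 ≤ ‖Q (X.isIdeal_interLinfty.cut (Ioc (m₀ : ℝ) (m : ℝ)) measurableSet_Ioc (x n))‖ := by
  obtain ⟨K, hK⟩ := X.exists_sum_norm_sq_cut_Ioc_le Q hx hC.le (m₀ : ℝ)
  have hcard : ∀ (s : Finset ℕ) (v : ℕ → H) (c : ℝ), 0 ≤ c → (∀ k ∈ s, c ≤ ‖v k‖) →
      (s.card : ℝ) * c ^ 2 ≤ ∑ k ∈ s, ‖v k‖ ^ 2 := by
    intro s v c hc hv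
    have := Finset.card_nsmul_le_sum s (fun k => ‖v k‖ ^ 2) (c ^ 2)
      fun k hk => pow_le_pow_left₀ hc (hv k hk) 2
    simpa using this
  have hA : {n : ℕ | 1 / 4 ≤ ‖Q (X.isIdeal_interLinfty.cut (Ioc 0 (m₀ : ℝ)) measurableSet_Ioc
      (x n))‖}.Finite := by
    refine finite_of_card_le (K := 16 * K) fun s hs => ?_
    have := (hcard s _ (1 / 4) (by norm_num) fun k hk => hs hk).trans (hK s)
    linarith
  have hB : {n : ℕ | ∀ᶠ m : ℕ in Filter.atTop, 1 / 2 ≤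
      ‖Q (X.isIdeal_interLinfty.cut (Ioi (m : ℝ)) measurableSet_Ioi (x n))‖}.Finite := by
    refine finite_of_card_le (K := 4 * (‖Q‖ * (Real.exp 1 * C)) ^ 2) fun s hs => ?_
    have h1 : ∀ᶠ m : ℕ in Filter.atTop, ∀ n ∈ s, 1 / 2 ≤
        ‖Q (X.isIdeal_interLinfty.cut (Ioi (m : ℝ)) measurableSet_Ioi (x n))‖ :=
      (Finset.eventually_all s).2 fun n hn => hs hn
    obtain ⟨m, h2, h3⟩ := (h1.and (X.eventually_sum_norm_sq_cut_Ioi_le Q hsep hx hC s)).exists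
    have := (hcard s _ (1 / 2) (by norm_num) h2).trans h3
    linarith
  obtain ⟨n, hn, hn0⟩ := ((hA.union hB).infinite_compl).exists_gt n₀
  simp only [mem_compl_iff, mem_union, mem_ofPred_eq, not_or, not_le] at hn
  obtain ⟨h1, h2⟩ := hn
  rw [Filter.not_eventually] at h2
  obtain ⟨m, hm, h3⟩ := (h2.and_eventually (Filter.eventually_ge_atTop m₀)).exists
  rw [not_le] at hm
  refine ⟨n, m, hn0, h3, ?_⟩
  -- `Q (x n)` has norm at least `1`; its parts on `(0, m₀]` and `(m, ∞)` take at most `1/4 + 1/2`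
  have h4 := congrArg Q (X.isIdeal_interLinfty.cut_Ioc_add_cut_Ioi (m : ℝ) (x n))
  rw [X.isIdeal_interLinfty.cut_Ioc_add (Nat.cast_nonneg m₀) (Nat.cast_le.2 h3), map_add,
    map_add] at h4
  have h5 := hQ n
  rw [← h4] at h5
  have h6 := h5.trans (norm_add₃_le)
  linarith

end Pieces

end SymmetricSpace

/-! ### Estimates for sums of disjoint pieces -/

/-- Only one term of a sum of disjoint numbers is nonzero. -/
theorem exists_forall_sum_mul_eq {ι : Type*} [Fintype ι] (y : ι → ℝ)
    (h : ∀ j k, j ≠ k → y j = 0 ∨ y k = 0) :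
    (∀ k, y k = 0) ∨ ∃ k, ∀ σ : ι → ℝ, ∑ j, σ j * y j = σ k * y k := by
  by_cases h0 : ∀ k, y k = 0
  · exact Or.inl h0
  · push Not at h0
    obtain ⟨k, hk⟩ := h0
    refine Or.inr ⟨k, fun σ => Finset.sum_eq_single k (fun j _ hj => ?_) (by simp)⟩
    rw [(h j k hj).resolve_right hk, mul_zero]

/-- A larger power of `n` is not dominated by a smaller one. -/
theorem not_forall_rpow_le {a b : ℝ} (hab : b < a) (K : ℝ) :
    ¬ ∀ n : ℕ, 1 ≤ n → (n : ℝ) ^ a ≤ K * (n : ℝ) ^ b := by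
  intro h
  have h1 := ((tendsto_rpow_atTop (sub_pos.2 hab)).comp tendsto_natCast_atTop_atTop)
  obtain ⟨n, h2, h3⟩ := ((h1.eventually_gt_atTop K).and (Filter.eventually_ge_atTop 1)).exists
  have hn : (0 : ℝ) < n := by exact_mod_cast h3
  have h4 := h n h3
  simp only [Function.comp_apply] at h2
  rw [Real.rpow_sub hn, lt_div_iff₀ (Real.rpow_pos_of_pos hn b)] at h2
  linarith

namespace SymmetricSpace

variable (X : SymmetricSpace)

theorem ae_coeFn_sum_boolSign {ι : Type*} [Fintype ι] (ρ : ExtNorm) (y : ι → ρ.space)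
    (ε : ι → Bool) : ∀ᵐ t ∂halfLine, ((∑ k, boolSign (ε k) • y k : ρ.space) : L0) t =
      ∑ k, boolSign (ε k) * (y k : L0) t := by
  have h1 : ∀ᵐ t ∂halfLine, ∀ k, (boolSign (ε k) • (y k : L0) : L0) t =
      boolSign (ε k) * (y k : L0) t := by
    rw [ae_all_iff]
    intro k
    filter_upwards [AEEqFun.coeFn_smul (boolSign (ε k)) (y k : L0)] with t ht
    rw [ht, Pi.smul_apply, smul_eq_mul]
  filter_upwards [h1, AEEqFun.coeFn_finsetSum Finset.univ
    fun k => (boolSign (ε k) • (y k : L0) : L0)] with t h2 h3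
  rw [AddSubmonoidClass.coe_finsetSum]
  refine h3.trans ?_
  rw [Finset.sum_apply]
  exact Finset.sum_congr rfl fun k _ => h2 k

theorem ae_coeFn_sum {ι : Type*} [Fintype ι] (ρ : ExtNorm) (y : ι → ρ.space) :
    ∀ᵐ t ∂halfLine, ((∑ k, y k : ρ.space) : L0) t = ∑ k, (y k : L0) t := by
  simpa using ae_coeFn_sum_boolSign ρ y fun _ => true

/-- If an operator into a Hilbert space is bounded below on the disjoint functions `y k`, then their
sum is large in `X`: for some choice of signs the image of the signed sum is large, and changing
signs does not affect the norm of `X`. -/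
theorem sqrt_card_le_of_disjoint {ι : Type*} [Fintype ι]
    {H : Type*} [NormedAddCommGroup H] [InnerProductSpace ℝ H] (Q : X.interLinfty.space →L[ℝ] H)
    (y : ι → X.interLinfty.space) {C c : ℝ} (hC : 0 ≤ C) (hc : 0 ≤ c)
    (hdisj : ∀ᵐ t ∂halfLine, ∀ j k, j ≠ k → (y j : L0) t = 0 ∨ (y k : L0) t = 0)
    (hb : ∀ᵐ t ∂halfLine, ∀ k, |(y k : L0) t| ≤ C) (hQ : ∀ k, c ≤ ‖Q (y k)‖) :
    c * √(Fintype.card ι) ≤ ‖Q‖ * max C ‖∑ k, X.toX (y k)‖ := by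
  classical
  obtain ⟨ε, hε⟩ := exists_signs_sum_norm_sq_le fun k => Q (y k)
  set W : X.interLinfty.space := ∑ k, boolSign (ε k) • y k with hW
  have hQW : ∑ k, boolSign (ε k) • Q (y k) = Q W := by simp [hW]
  rw [hQW] at hε
  have h1 : c * √(Fintype.card ι) ≤ ‖Q W‖ := by
    refine abs_le_of_sq_le_sq' ?_ (norm_nonneg _) |>.2
    rw [mul_pow, Real.sq_sqrt (Nat.cast_nonneg _)]
    refine le_trans ?_ hε
    have := Finset.card_nsmul_le_sum Finset.univ (fun k => ‖Q (y k)‖ ^ 2) (c ^ 2)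
      fun k _ => pow_le_pow_left₀ hc (hQ k) 2
    rw [mul_comm]
    simpa using this
  refine h1.trans ((Q.le_opNorm W).trans (mul_le_mul_of_nonneg_left ?_ (norm_nonneg _)))
  refine X.norm_interLinfty_le ?_ ?_
  · refine le_trans (X.isIdeal.norm_le_of_ae ?_) (le_max_right _ _)
    filter_upwards [hdisj, ae_coeFn_sum_boolSign _ y ε, ae_coeFn_sum X.toExtNorm
      fun k => X.toX (y k)] with t h2 h3 h4
    rw [h4]
    change |(W : L0) t| ≤ |∑ k, (y k : L0) t|
    rw [hW, h3]
    rcases exists_forall_sum_mul_eq (fun k => (y k : L0) t) h2 with h5 | ⟨k, h5⟩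
    · simp [h5]
    · have h6 := h5 fun _ => 1
      simp only [one_mul] at h6
      rw [h5, h6, abs_mul, abs_boolSign, one_mul]
  · filter_upwards [hdisj, hb, ae_coeFn_sum_boolSign _ y ε] with t h2 h3 h4
    refine le_trans ?_ (le_max_left _ _)
    rw [h4]
    rcases exists_forall_sum_mul_eq (fun k => (y k : L0) t) h2 with h5 | ⟨k, h5⟩
    · simpa [h5] using hC
    · rw [h5, abs_mul, abs_boolSign, one_mul]
      exact h3 k

/-- The sum of disjoint pieces of the functions `z k` is dominated by the average of the moduli of
the signed sums of the `z k`. -/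
theorem norm_sum_toX_le {ι : Type*} [Fintype ι] (y z : ι → X.interLinfty.space) {R : ℝ}
    (hdisj : ∀ᵐ t ∂halfLine, ∀ j k, j ≠ k → (y j : L0) t = 0 ∨ (y k : L0) t = 0)
    (hyz : ∀ᵐ t ∂halfLine, ∀ k, |(y k : L0) t| ≤ |(z k : L0) t|)
    (hz : ∀ ε : ι → Bool, ‖∑ k, boolSign (ε k) • z k‖ ≤ R) :
    ‖∑ k, X.toX (y k)‖ ≤ R := by
  classical
  set M : ℝ := 2 ^ Fintype.card ι with hM
  have hM0 : 0 < M := by positivity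
  let W : (ι → Bool) → X.interLinfty.space := fun ε => ∑ k, boolSign (ε k) • z k
  let G : L0 := ∑ ε : ι → Bool, |(W ε : L0)|
  have hG : ∀ᵐ t ∂halfLine, G t = ∑ ε : ι → Bool, |∑ k, boolSign (ε k) * (z k : L0) t| := by
    have h1 : ∀ᵐ t ∂halfLine, ∀ ε, |(W ε : L0)| t = |∑ k, boolSign (ε k) * (z k : L0) t| := by
      rw [ae_all_iff]
      intro ε
      filter_upwards [AEEqFun.coeFn_abs (W ε : L0), ae_coeFn_sum_boolSign _ z ε] with t h2 h3
      rw [h2, h3]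
    filter_upwards [h1, AEEqFun.coeFn_finsetSum Finset.univ fun ε => |(W ε : L0)|] with t h2 h3
    refine h3.trans ?_
    rw [Finset.sum_apply]
    exact Finset.sum_congr rfl fun ε _ => h2 ε
  have hR : 0 ≤ R := (norm_nonneg _).trans (hz fun _ => true)
  have h1 : X.toFun ((M • ∑ k, X.toX (y k) : X.space) : L0) ≤ ENNReal.ofReal (M * R) := by
    calc X.toFun ((M • ∑ k, X.toX (y k) : X.space) : L0) ≤ X.toFun G := by
          refine X.isIdeal.le_of_ae ?_
          rw [Submodule.coe_smul]
          filter_upwards [hG, hdisj, hyz, ae_coeFn_sum X.toExtNorm fun k => X.toX (y k),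
            AEEqFun.coeFn_smul M ((∑ k, X.toX (y k) : X.space) : L0)] with t h2 h3 h4 h5 h6
          rw [h6, Pi.smul_apply, h5, h2, smul_eq_mul]
          refine le_trans ?_ (le_abs_self _)
          change |M * ∑ k, (y k : L0) t| ≤ _
          rcases exists_forall_sum_mul_eq (fun k => (y k : L0) t) h3 with h7 | ⟨k, h7⟩
          · simp only [h7, Finset.sum_const_zero, mul_zero, abs_zero]
            exact Finset.sum_nonneg fun _ _ => abs_nonneg _
          · have h8 := h7 fun _ => 1
            simp only [one_mul] at h8
            rw [h8, abs_mul, abs_of_pos hM0]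
            exact (mul_le_mul_of_nonneg_left (h4 k) hM0.le).trans
              (abs_le_sum_abs_sum_boolSign (fun k => (z k : L0) t) k)
      _ ≤ ∑ ε, X.toFun |(W ε : L0)| := X.toExtNorm.sum_le _ _
      _ ≤ ∑ _ε : ι → Bool, ENNReal.ofReal R := by
          refine Finset.sum_le_sum fun ε _ => ?_
          rw [X.isIdeal.toFun_abs, ← X.coe_toX, X.toFun_coe]
          exact ENNReal.ofReal_le_ofReal ((X.norm_toX_le _).trans (hz ε))
      _ = ENNReal.ofReal (M * R) := by
          rw [ENNReal.ofReal_mul hM0.le, hM, ENNReal.ofReal_pow (by norm_num)]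
          simp
  have h2 : ‖M • ∑ k, X.toX (y k)‖ ≤ M * R :=
    ENNReal.toReal_le_of_le_ofReal (by positivity) h1
  rw [norm_smul, Real.norm_eq_abs, abs_of_pos hM0] at h2
  exact le_of_mul_le_mul_left h2 hM0

variable {X}

theorem UpperEstimate.exists_finset {p : ℝ} (h : X.UpperEstimate p) :
    ∃ C : ℝ, ∀ (y : ℕ → X.space), (∀ j k, j ≠ k → (y j : L0) * (y k : L0) = 0) →
      ∀ s : Finset ℕ, ‖∑ k ∈ s, y k‖ ≤ C * (∑ k ∈ s, ‖y k‖ ^ p) ^ (1 / p) := by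
  obtain ⟨C, hC⟩ := h
  refine ⟨C, fun y hy s => ?_⟩
  have h1 := hC s.card (fun i => y (s.equivFin.symm i)) fun i j hij => hy _ _ fun h => hij
    (s.equivFin.symm.injective (Subtype.ext h))
  rwa [Equiv.sum_comp s.equivFin.symm (fun k : s => y k),
    Equiv.sum_comp s.equivFin.symm (fun k : s => ‖y k‖ ^ p), Finset.sum_coe_sort s y,
    Finset.sum_coe_sort s fun k => ‖y k‖ ^ p] at h1

theorem LowerEstimate.exists_finset {q : ℝ} (h : X.LowerEstimate q) :
    ∃ C : ℝ, ∀ (y : ℕ → X.space), (∀ j k, j ≠ k → (y j : L0) * (y k : L0) = 0) →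
      ∀ s : Finset ℕ, (∑ k ∈ s, ‖y k‖ ^ q) ^ (1 / q) ≤ C * ‖∑ k ∈ s, y k‖ := by
  obtain ⟨C, hC⟩ := h
  refine ⟨C, fun y hy s => ?_⟩
  have h1 := hC s.card (fun i => y (s.equivFin.symm i)) fun i j hij => hy _ _ fun h => hij
    (s.equivFin.symm.injective (Subtype.ext h))
  rwa [Equiv.sum_comp s.equivFin.symm (fun k : s => y k),
    Equiv.sum_comp s.equivFin.symm (fun k : s => ‖y k‖ ^ q), Finset.sum_coe_sort s y,
    Finset.sum_coe_sort s fun k => ‖y k‖ ^ q] at h1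

variable (X)

/-- `X ∩ L_∞` contains no sequence with an upper `l_2`-estimate on which an operator into a Hilbert
space is bounded below. -/
theorem false_of_upper_sq_estimate (hsep : TopologicalSpace.SeparableSpace X.space)
    (hX : (∃ p : ℝ, 2 < p ∧ X.UpperEstimate p) ∨
      (∃ q : ℝ, 1 ≤ q ∧ q < 2 ∧ X.LowerEstimate q))
    {H : Type*} [NormedAddCommGroup H] [InnerProductSpace ℝ H]
    (Q : X.interLinfty.space →L[ℝ] H) {x : ℕ → X.interLinfty.space} {C : ℝ}
    (hx : ∀ (s : Finset ℕ) (a : ℕ → ℝ), ‖∑ k ∈ s, a k • x k‖ ≤ C * √(∑ k ∈ s, a k ^ 2))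
    (hC : 0 < C) (hQ : ∀ n, 1 ≤ ‖Q (x n)‖) : False := by
  choose n m hn hm hnm using X.exists_cut_Ioc_norm_ge Q hsep hx hC hQ
  -- `P k` holds the left end of the `k`-th interval and the last index used before it
  let P : ℕ → ℕ × ℕ := fun k => (fun r : ℕ × ℕ => (m r.1 r.2, n r.1 r.2))^[k] (0, 0)
  have hP : ∀ k, P (k + 1) = (m (P k).1 (P k).2, n (P k).1 (P k).2) := fun k =>
    Function.iterate_succ_apply' _ k _
  have hP1 : Monotone fun k => (P k).1 := monotone_nat_of_le_succ fun k => by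
    rw [hP]; exact hm _ _
  let idx : ℕ → ℕ := fun k => (P (k + 1)).2
  have hidx : StrictMono idx := strictMono_nat_of_lt_succ fun k => by
    change (P (k + 1)).2 < (P (k + 1 + 1)).2
    rw [hP (k + 1)]; exact hn _ _
  let D : ℕ → Set ℝ := fun k => Ioc ((P k).1 : ℝ) ((P (k + 1)).1 : ℝ)
  have hDm : ∀ k, MeasurableSet (D k) := fun k => measurableSet_Ioc
  have hDdisj : ∀ j k, j < k → Disjoint (D j) (D k) := fun j k hjk =>
    Ioc_disjoint_Ioc_of_le (by exact_mod_cast hP1 (Nat.succ_le_of_lt hjk))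
  have hDdisj' : ∀ j k, j ≠ k → Disjoint (D j) (D k) := fun j k hjk =>
    (lt_or_gt_of_ne hjk).elim (hDdisj j k) fun h => (hDdisj k j h).symm
  let z : ℕ → X.interLinfty.space := fun k => x (idx k)
  let y : ℕ → X.interLinfty.space := fun k => X.isIdeal_interLinfty.cut (D k) (hDm k) (z k)
  have hyQ : ∀ k, 1 / 4 ≤ ‖Q (y k)‖ := by
    intro k
    have h1 := hnm (P k).1 (P k).2
    have h2 : D k = Ioc ((P k).1 : ℝ) (m (P k).1 (P k).2 : ℝ) := by
      simp only [D, hP]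
    simp only [y, h2]
    have h3 : z k = x (n (P k).1 (P k).2) := by simp only [z, idx, hP]
    rw [h3]
    exact h1
  have hyD : ∀ᵐ t ∂halfLine, ∀ k, (y k : L0) t = (D k).indicator (z k : L0) t := by
    rw [ae_all_iff]
    exact fun k => X.isIdeal_interLinfty.coeFn_cut _ _ _
  have hdisj : ∀ᵐ t ∂halfLine, ∀ j k, j ≠ k → (y j : L0) t = 0 ∨ (y k : L0) t = 0 := by
    filter_upwards [hyD] with t ht j k hjk
    rw [ht, ht]
    by_cases h : t ∈ D j
    · exact Or.inr (indicator_of_notMem (disjoint_left.1 (hDdisj' j k hjk) h) _)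
    · exact Or.inl (indicator_of_notMem h _)
  have hyz : ∀ᵐ t ∂halfLine, ∀ k, |(y k : L0) t| ≤ |(z k : L0) t| := by
    filter_upwards [hyD] with t ht k
    rw [ht]
    by_cases h : t ∈ D k <;> simp [h]
  have hzC : ∀ k, ‖z k‖ ≤ C := by
    intro k
    have := hx {idx k} fun _ => 1
    simpa using this
  have hyC : ∀ k, ‖X.toX (y k)‖ ≤ C := fun k =>
    (X.norm_toX_le _).trans ((X.isIdeal_interLinfty.norm_cut_le _ _ _).trans (hzC k))
  have hyb : ∀ᵐ t ∂halfLine, ∀ k, |(y k : L0) t| ≤ C := by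
    have h1 : ∀ᵐ t ∂halfLine, ∀ k, |(z k : L0) t| ≤ C := by
      rw [ae_all_iff]
      intro k
      filter_upwards [X.ae_abs_le_norm (z k)] with t ht using ht.trans (hzC k)
    filter_upwards [h1, hyz] with t h2 h3 k using (h3 k).trans (h2 k)
  have hmul : ∀ j k, j ≠ k → (X.toX (y j) : L0) * (X.toX (y k) : L0) = 0 := by
    intro j k hjk
    refine AEEqFun.ext ?_
    filter_upwards [hdisj, AEEqFun.coeFn_mul (y j : L0) (y k : L0),
      AEEqFun.coeFn_zero (α := ℝ) (β := ℝ) (μ := halfLine)] with t h1 h2 h3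
    rw [X.coe_toX, X.coe_toX, h2, h3, Pi.mul_apply]
    rcases h1 j k hjk with h | h <;> simp [h]
  have hlow : ∀ s : Finset ℕ,
      1 / 4 * √(s.card : ℝ) ≤ ‖Q‖ * max C ‖∑ k ∈ s, X.toX (y k)‖ := by
    intro s
    have h1 := X.sqrt_card_le_of_disjoint Q (fun k : s => y k) hC.le (by norm_num : (0 : ℝ) ≤ 1 / 4)
      (hdisj.mono fun t h j k hjk => h _ _ fun h' => hjk (Subtype.ext h'))
      (hyb.mono fun t h k => h k) fun k => hyQ k
    rwa [Fintype.card_coe, Finset.sum_coe_sort s fun k => X.toX (y k)] at h1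
  rcases hX with ⟨p, hp, hX⟩ | ⟨q, hq1, hq2, hX⟩
  · obtain ⟨B, hB⟩ := hX.exists_finset
    have hp0 : 0 < p := by linarith
    refine not_forall_rpow_le (a := 1 / 2) (b := 1 / p)
      (one_div_lt_one_div_of_lt (by norm_num) hp) (4 * (‖Q‖ * (C + |B| * C))) fun N hN => ?_
    have hN1 : (1 : ℝ) ≤ (N : ℝ) ^ (1 / p) :=
      Real.one_le_rpow (by exact_mod_cast hN) (by positivity)
    have h1 := hB (fun k => X.toX (y k)) hmul (Finset.range N)
    have h2 : (∑ k ∈ Finset.range N, ‖X.toX (y k)‖ ^ p) ^ (1 / p) ≤ (N : ℝ) ^ (1 / p) * C := by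
      calc (∑ k ∈ Finset.range N, ‖X.toX (y k)‖ ^ p) ^ (1 / p) ≤ (N * C ^ p) ^ (1 / p) := by
            refine Real.rpow_le_rpow (Finset.sum_nonneg fun k _ => by positivity) ?_
              (by positivity)
            have := Finset.sum_le_card_nsmul (Finset.range N) (fun k => ‖X.toX (y k)‖ ^ p) (C ^ p)
              fun k _ => Real.rpow_le_rpow (norm_nonneg _) (hyC k) hp0.le
            simpa using this
        _ = (N : ℝ) ^ (1 / p) * C := by
            rw [Real.mul_rpow (by positivity) (by positivity), one_div,
              Real.rpow_rpow_inv hC.le hp0.ne']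
    have h3 : ‖∑ k ∈ Finset.range N, X.toX (y k)‖ ≤ |B| * ((N : ℝ) ^ (1 / p) * C) :=
      h1.trans ((mul_le_mul_of_nonneg_right (le_abs_self B) (by positivity)).trans
        (mul_le_mul_of_nonneg_left h2 (abs_nonneg B)))
    have h4 : max C ‖∑ k ∈ Finset.range N, X.toX (y k)‖ ≤ (C + |B| * C) * (N : ℝ) ^ (1 / p) := by
      have h5 : 0 ≤ |B| * C * (N : ℝ) ^ (1 / p) := by positivity
      refine max_le ?_ ?_ <;> nlinarith
    have h5 := (hlow (Finset.range N)).trans (mul_le_mul_of_nonneg_left h4 (norm_nonneg Q))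
    rw [Finset.card_range, Real.sqrt_eq_rpow] at h5
    linarith
  · obtain ⟨B, hB⟩ := hX.exists_finset
    have hq0 : 0 < q := by linarith
    have hup : ∀ s : Finset ℕ, ‖∑ k ∈ s, X.toX (y k)‖ ≤ C * √(s.card : ℝ) := by
      intro s
      have h1 := X.norm_sum_toX_le (fun k : s => y k) (fun k : s => z k) (R := C * √(s.card : ℝ))
        (hdisj.mono fun t h j k hjk => h _ _ fun h' => hjk (Subtype.ext h'))
        (hyz.mono fun t h k => h k) fun ε => ?_
      · rwa [Finset.sum_coe_sort s fun k => X.toX (y k)] at h1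
      let σ : ℕ → ℝ := fun k => if hk : k ∈ s then boolSign (ε ⟨k, hk⟩) else 0
      have h2 := hx (s.map ⟨idx, hidx.injective⟩) (Function.extend idx σ 0)
      simp only [Finset.sum_map, Function.Embedding.coeFn_mk, hidx.injective.extend_apply] at h2
      rw [← Finset.sum_coe_sort s fun k => σ k • x (idx k),
        ← Finset.sum_coe_sort s fun k => σ k ^ 2] at h2
      simpa [σ, pow_two, boolSign_mul_self] using h2
    -- infinitely many of the pieces have norm at least `1 / M` in `X`
    obtain ⟨M, hM⟩ : ∃ M : ℕ, 4 * (‖Q‖ * max C 1) < √(M : ℝ) := by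
      obtain ⟨M, hM⟩ := exists_nat_gt ((4 * (‖Q‖ * max C 1)) ^ 2)
      exact ⟨M, Real.lt_sqrt_of_sq_lt hM⟩
    have hM0 : (0 : ℝ) < M := by
      refine Real.sqrt_pos.1 (lt_of_le_of_lt ?_ hM)
      positivity
    have hinf : {k : ℕ | 1 / (M : ℝ) ≤ ‖X.toX (y k)‖}.Infinite := by
      intro hfin
      obtain ⟨s, hs, hsM⟩ := hfin.infinite_compl.exists_subset_card_eq M
      have h1 : ‖∑ k ∈ s, X.toX (y k)‖ ≤ 1 := by
        refine (norm_sum_le _ _).trans ?_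
        have := Finset.sum_le_card_nsmul s (fun k => ‖X.toX (y k)‖) (1 / (M : ℝ))
          fun k hk => by
            have h := hs hk
            rw [mem_compl_iff, mem_ofPred_eq, not_le] at h
            exact h.le
        rw [hsM, nsmul_eq_mul, mul_one_div_cancel hM0.ne'] at this
        exact this
      have h2 := (hlow s).trans (mul_le_mul_of_nonneg_left (max_le_max le_rfl h1) (norm_nonneg Q))
      rw [hsM] at h2
      linarith
    refine not_forall_rpow_le (a := 1 / q) (b := 1 / 2) (one_div_lt_one_div_of_lt hq0 hq2)
      (M * (|B| * C)) fun N _ => ?_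
    obtain ⟨s, hs, hsN⟩ := hinf.exists_subset_card_eq N
    have h1 := hB (fun k => X.toX (y k)) hmul s
    have h2 : (N : ℝ) ^ (1 / q) * (1 / M) ≤ (∑ k ∈ s, ‖X.toX (y k)‖ ^ q) ^ (1 / q) := by
      calc (N : ℝ) ^ (1 / q) * (1 / M) = (N * (1 / M) ^ q) ^ (1 / q) := by
            rw [Real.mul_rpow (by positivity) (by positivity), one_div q,
              Real.rpow_rpow_inv (by positivity) hq0.ne']
        _ ≤ (∑ k ∈ s, ‖X.toX (y k)‖ ^ q) ^ (1 / q) := by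
            refine Real.rpow_le_rpow (by positivity) ?_ (by positivity)
            have := Finset.card_nsmul_le_sum s (fun k => ‖X.toX (y k)‖ ^ q) ((1 / M) ^ q)
              fun k hk => Real.rpow_le_rpow (by positivity) (hs hk) hq0.le
            rw [hsN] at this
            simpa using this
    have h3 : B * ‖∑ k ∈ s, X.toX (y k)‖ ≤ |B| * (C * √(N : ℝ)) := by
      have := hup s
      rw [hsN] at this
      exact (mul_le_mul_of_nonneg_right (le_abs_self B) (norm_nonneg _)).trans
        (mul_le_mul_of_nonneg_left this (abs_nonneg B))
    have h4 := h2.trans (h1.trans h3)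
    rw [mul_one_div, div_le_iff₀ hM0, Real.sqrt_eq_rpow] at h4
    linarith

end SymmetricSpace

/-! ### Complemented copies of `l_2` as factorizations of the identity -/

/-- If `E` contains a complemented copy of `l_2`, the identity of `l_2` factors through `E`. -/
theorem HasComplementedSeqL2.exists_factorization {E : Type} [NormedAddCommGroup E]
    [NormedSpace ℝ E] (h : HasComplementedSeqL2 E) :
    ∃ (J : SeqL2 →L[ℝ] E) (Q : E →L[ℝ] SeqL2), ∀ v, Q (J v) = v := by
  obtain ⟨S, ⟨P, hP⟩, ⟨e⟩⟩ := h
  refine ⟨S.subtypeL.comp (e.symm : SeqL2 →L[ℝ] S), (e : S →L[ℝ] SeqL2).comp P, fun v => ?_⟩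
  simp [hP]

theorem norm_sum_smul_single (s : Finset ℕ) (a : ℕ → ℝ) :
    ‖∑ k ∈ s, a k • (lp.single 2 k (1 : ℝ) : SeqL2)‖ = √(∑ k ∈ s, a k ^ 2) := by
  have h := lp.norm_sum_single (E := fun _ : ℕ => ℝ) (p := 2) (by simp) a s
  simp only [ENNReal.toReal_ofNat, Real.rpow_ofNat, Real.norm_eq_abs, sq_abs] at h
  rw [← h, Real.sqrt_sq (norm_nonneg _)]
  congr 1
  refine Finset.sum_congr rfl fun k _ => ?_
  rw [← lp.single_smul, smul_eq_mul, mul_one]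

namespace SymmetricSpace

variable (X : SymmetricSpace)

theorem not_exists_factorization_interLinfty (hsep : TopologicalSpace.SeparableSpace X.space)
    (hX : (∃ p : ℝ, 2 < p ∧ X.UpperEstimate p) ∨
      (∃ q : ℝ, 1 ≤ q ∧ q < 2 ∧ X.LowerEstimate q))
    (J : SeqL2 →L[ℝ] X.interLinfty.space) (Q : X.interLinfty.space →L[ℝ] SeqL2) :
    ¬ ∀ v, Q (J v) = v := by
  intro h
  refine X.false_of_upper_sq_estimate hsep hX Q (x := fun k => J (lp.single 2 k 1))
    (C := ‖J‖ + 1) (fun s a => ?_) (by positivity) fun k => ?_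
  · have h1 : ∑ k ∈ s, a k • J (lp.single 2 k 1) =
        J (∑ k ∈ s, a k • (lp.single 2 k (1 : ℝ) : SeqL2)) := by simp
    rw [h1]
    refine (J.le_opNorm _).trans ?_
    rw [norm_sum_smul_single]
    gcongr
    linarith
  · rw [h, lp.norm_single (by norm_num)]
    simp

/-! ### `X[0, 1]` is complemented in `X + L_∞` -/

theorem toFun_ind_mul_le_sumNorm (A : Set ℝ) (hA : MeasurableSet A) (f : L0) :
    X.toFun (ind A hA * f) ≤ (1 + X.toFun (ind A hA)) * X.sumNorm f := by
  by_cases hK : X.toFun (ind A hA) = ∞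
  · by_cases hf : X.sumNorm f = 0
    · have h0 : X.toFun 0 = 0 := X.map_zero
      have h1 : ind A hA * (0 : L0) = 0 := by simpa using ind_mul_smul A hA 0 0
      rw [X.eq_zero_of_sumNorm f hf, h1, h0]
      exact zero_le
    · rw [hK, add_top, ENNReal.top_mul hf]
      exact le_top
  have hK' : 1 + X.toFun (ind A hA) ≠ ∞ := ENNReal.add_ne_top.2 ⟨ENNReal.one_ne_top, hK⟩
  have hK0 : 1 + X.toFun (ind A hA) ≠ 0 := by simp
  rw [sumNorm]
  simp only [ENNReal.mul_iInf_of_ne hK0 hK']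
  refine le_iInf fun u => le_iInf fun v => le_iInf fun h => ?_
  subst h
  by_cases hv : supNorm v = ∞
  · rw [hv, add_top, ENNReal.mul_top hK0]
    exact le_top
  have hvA : X.toFun (ind A hA * v) ≤ supNorm v * X.toFun (ind A hA) := by
    have h1 : X.toFun (ind A hA * v) ≤ X.toFun ((supNorm v).toReal • ind A hA) := by
      refine X.isIdeal.le_of_ae ?_
      filter_upwards [coeFn_ind_mul A hA v, coeFn_ind A hA,
        AEEqFun.coeFn_smul (supNorm v).toReal (ind A hA),
        ae_abs_le_of_supNorm_le (f := v) ENNReal.toReal_nonneg (ENNReal.ofReal_toReal hv).ge]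
        with t h2 h3 h4 h5
      rw [h2, h4, Pi.smul_apply, h3]
      by_cases ht : t ∈ A
      · simpa [ht] using h5
      · simp [ht]
    rwa [X.smul, Real.enorm_of_nonneg ENNReal.toReal_nonneg, ENNReal.ofReal_toReal hv] at h1
  calc X.toFun (ind A hA * (u + v)) ≤ X.toFun (ind A hA * u) + X.toFun (ind A hA * v) := by
        rw [ind_mul_add]
        exact X.add_le _ _
    _ ≤ X.toFun u + supNorm v * X.toFun (ind A hA) :=
        add_le_add (X.isIdeal.ind_mul_le A hA u) hvA
    _ ≤ (1 + X.toFun (ind A hA)) * (X.toFun u + supNorm v) := by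
        rw [add_mul, one_mul, mul_add, mul_comm (supNorm v)]
        exact add_le_add le_self_add le_add_self

theorem toFun_ind_Icc_ne_top : X.toFun (ind (Icc 0 1) measurableSet_Icc) ≠ ∞ :=
  ne_top_of_le_ne_top (X.toFun_ind_Ioc_ne_top 1)
    (X.toFun_ind_mono _ _ fun _ h0 ht => ⟨h0, ht.2⟩)

/-- The inclusion of `X[0, 1]` into `X + L_∞`. -/
noncomputable def unitIntervalToSum : X.unitInterval →L[ℝ] X.sumLinfty.space :=
  have h : ∀ f : L0, X.sumNorm f ≤ X.toFun f := fun f => by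
    have h0 : supNorm 0 = 0 := by simpa using supNorm_smul 0 0
    simpa [h0] using X.sumNorm_le f 0
  LinearMap.mkContinuous
    { toFun := fun f => ⟨(f : X.space), ne_top_of_le_ne_top (f : X.space).2 (h _)⟩
      map_add' := fun _ _ => rfl
      map_smul' := fun _ _ => rfl } 1 fun f => by
    rw [one_mul]
    exact ENNReal.toReal_mono (f : X.space).2 (h _)

/-- The restriction to `[0, 1]`, as an operator from `X + L_∞` to `X[0, 1]`. -/
noncomputable def sumToUnitInterval : X.sumLinfty.space →L[ℝ] X.unitInterval :=
  have hK : 1 + X.toFun (ind (Icc 0 1) measurableSet_Icc) ≠ ∞ :=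
    ENNReal.add_ne_top.2 ⟨ENNReal.one_ne_top, X.toFun_ind_Icc_ne_top⟩
  have hfin : ∀ f : X.sumLinfty.space, (1 + X.toFun (ind (Icc 0 1) measurableSet_Icc)) *
      X.sumNorm f ≠ ∞ := fun f => ENNReal.mul_ne_top hK f.2
  LinearMap.mkContinuous
    { toFun := fun f => ⟨⟨ind (Icc 0 1) measurableSet_Icc * f,
        ne_top_of_le_ne_top (hfin f) (X.toFun_ind_mul_le_sumNorm _ _ _)⟩, by
          filter_upwards [coeFn_ind_mul (Icc 0 1) measurableSet_Icc f] with t h ht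
          exact h.trans (indicator_of_notMem ht _)⟩
      map_add' := fun f g => Subtype.ext (Subtype.ext (ind_mul_add _ _ _ _))
      map_smul' := fun c f => Subtype.ext (Subtype.ext (ind_mul_smul _ _ _ _)) }
    (1 + X.toFun (ind (Icc 0 1) measurableSet_Icc)).toReal fun f => by
      rw [ExtNorm.norm_def, ← ENNReal.toReal_mul]
      exact ENNReal.toReal_mono (hfin f) (X.toFun_ind_mul_le_sumNorm _ _ _)

theorem sumToUnitInterval_unitIntervalToSum (f : X.unitInterval) :
    X.sumToUnitInterval (X.unitIntervalToSum f) = f := by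
  refine Subtype.ext (Subtype.ext (AEEqFun.ext ?_))
  change (ind (Icc 0 1) measurableSet_Icc * ((f : X.space) : L0) : L0) =ᵐ[halfLine] _
  filter_upwards [coeFn_ind_mul (Icc 0 1) measurableSet_Icc ((f : X.space) : L0), f.2] with t h1 h2
  rw [h1]
  by_cases ht : t ∈ Icc (0 : ℝ) 1
  · rw [indicator_of_mem ht]
  · rw [indicator_of_notMem ht, h2 ht]

end SymmetricSpace

end SymmSpaces

theorem theorem5 (X : SymmSpaces.SymmetricSpace)
    (hsep : TopologicalSpace.SeparableSpace X.space)
    (hX : (∃ p : ℝ, 2 < p ∧ X.UpperEstimate p) ∨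
      (∃ q : ℝ, 1 ≤ q ∧ q < 2 ∧ X.LowerEstimate q)) :
    ¬ SymmSpaces.HasComplementedSeqL2 X.interLinfty.space ∧
    (SymmSpaces.HasComplementedSeqL2 X.unitInterval →
      IsEmpty (X.interLinfty.space ≃L[ℝ] X.sumLinfty.space)) := by
  refine ⟨fun h => ?_, fun h => ⟨fun e => ?_⟩⟩
  · obtain ⟨J, Q, hQ⟩ := h.exists_factorization
    exact X.not_exists_factorization_interLinfty hsep hX J Q hQ
  · obtain ⟨J, Q, hQ⟩ := h.exists_factorization
    refine X.not_exists_factorization_interLinfty hsep hX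
      ((e.symm : X.sumLinfty.space →L[ℝ] X.interLinfty.space).comp (X.unitIntervalToSum.comp J))
      (Q.comp (X.sumToUnitInterval.comp (e : X.interLinfty.space →L[ℝ] X.sumLinfty.space)))
      fun v => ?_
    simp [X.sumToUnitInterval_unitIntervalToSum, hQ]
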